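/- For $n\ge 1$ let $\mathbb R^{2n}$ have coordinates $x_1,\dots,x_n,y_1,\dots,y_n$ and symplectic form $\omega=\sum_j dx_j\wedge dy_j$, and identify $\mathbb R^{2n}=\mathbb C^n$ via $z_j=x_j+iy_j$. Let $\mathrm{LGr}(n)$ be the set of Lagrangian subspaces of $\mathbb R^{2n}$, and let $\mathcal U(n)$ be the set of $\mathbb C$-valued alternating $\mathbb R$-multilinear $n$-forms $\Omega$ on $\mathbb R^{2n}$ such that $\omega\wedge\Omega=0$ and $\Omega|_L\neq 0$ for every $L\in\mathrm{LGr}(n)$. Each $\Omega\in\mathcal U(n)$ defines a phase map $$\phi_\Omega:\mathrm{LGr}(n)\to\mathbb R/\pi\mathbb Z,\qquad L\mapsto\operatorname{Arg}(\Omega|_L),$$ where $\Omega|_L$ is evaluated on any basis of $L$. Let $\mathcal U^+(n)$ (resp. $\mathcal U^-(n)$) be the set of $\Omega\in\mathcal U(n)$ such that $\phi_\Omega$ sends the canonical generator of $\pi_1(\mathrm{LGr}(n))\cong\mathbb Z$, represented by the loop $\mathbb R/\pi\mathbb Z\to\mathrm{LGr}(n)$, $\theta\mapsto e^{i\theta}\mathbb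 R\times\mathbb R^{n-1}\subset\mathbb C^n$, to a positive (resp. negative) element of $\pi_1(\mathbb R/\pi\mathbb Z)\cong\mathbb Z$, that is, to a loop of positive (resp. negative) degree. Proposition. Let $\Omega\in\mathcal U(3)$. Then $\Omega\wedge\overline\Omega\neq 0$. Moreover, if $\Omega\in\mathcal U^+(3)$, then $i\,\Omega\wedge\overline\Omega=c\,\omega^3$ for some real $c>0$, and if $\Omega\in\mathcal U^-(3)$, then $i\,\Omega\wedge\overline\Omega=c\,\omega^3$ for some real $c<0$. -/

import Mathlib

open scoped ComplexConjugate

noncomputable section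

namespace LagrangianForms

/-- `ℝ²ⁿ` with coordinates `(x₁, …, xₙ, y₁, …, yₙ)`; `v.1` are the `x`- and `v.2` the
`y`-coordinates. It is identified with `ℂⁿ` through `zⱼ = xⱼ + i yⱼ`. -/
abbrev R2n (n : ℕ) : Type := (Fin n → ℝ) × (Fin n → ℝ)

/-- Wedge product of alternating forms with values in a commutative `ℝ`-algebra `A`:
`(α ∧ β)(v₁, …, v_{p+q}) = ∑ sgn σ · α(v_{σ 1}, …, v_{σ p}) · β(v_{σ (p+1)}, …, v_{σ (p+q)})`,
the sum being over all `(p,q)`-shuffles `σ`. -/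
def wedge {V A : Type*} [AddCommGroup V] [Module ℝ V] [CommRing A] [Algebra ℝ A] {p q : ℕ}
    (α : V [⋀^Fin p]→ₗ[ℝ] A) (β : V [⋀^Fin q]→ₗ[ℝ] A) : V [⋀^Fin (p + q)]→ₗ[ℝ] A :=
  ((LinearMap.mul' ℝ A).compAlternatingMap (α.domCoprod β)).domDomCongr finSumFinEquiv

/-- The standard symplectic form `ω = ∑ⱼ dxⱼ ∧ dyⱼ` on `ℝ²ⁿ`. -/
def stdSymp (n : ℕ) : R2n n [⋀^Fin 2]→ₗ[ℝ] ℝ where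
  toFun v := ∑ j, ((v 0).1 j * (v 1).2 j - (v 0).2 j * (v 1).1 j)
  map_update_add' := by
    intro inst v i x y
    rw [Subsingleton.elim inst (instDecidableEqFin 2), ← Finset.sum_add_distrib]
    refine Finset.sum_congr rfl fun j _ => ?_
    fin_cases i <;> simp <;> ring
  map_update_smul' := by
    intro inst v i c x
    rw [Subsingleton.elim inst (instDecidableEqFin 2), smul_eq_mul, Finset.mul_sum]
    refine Finset.sum_congr rfl fun j _ => ?_
    fin_cases i <;> simp <;> ring
  map_eq_zero_of_eq' v i j hv hij := by
    have h : v 0 = v 1 := by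
      fin_cases i <;> fin_cases j <;> simp_all
    exact Finset.sum_eq_zero fun k _ => by rw [h]; ring

theorem stdSymp_apply (n : ℕ) (v : Fin 2 → R2n n) :
    stdSymp n v = ∑ j, ((v 0).1 j * (v 1).2 j - (v 0).2 j * (v 1).1 j) := rfl

/-- A real-valued form regarded as a complex-valued form. -/
def complexify {V : Type*} [AddCommGroup V] [Module ℝ V] {p : ℕ} (α : V [⋀^Fin p]→ₗ[ℝ] ℝ) :
    V [⋀^Fin p]→ₗ[ℝ] ℂ :=
  Complex.ofRealCLM.toLinearMap.compAlternatingMap α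

/-- The complex conjugate of a complex-valued form. -/
def conjForm {V : Type*} [AddCommGroup V] [Module ℝ V] {p : ℕ} (α : V [⋀^Fin p]→ₗ[ℝ] ℂ) :
    V [⋀^Fin p]→ₗ[ℝ] ℂ :=
  Complex.conjAe.toLinearMap.compAlternatingMap α

/-- The standard symplectic form of `ℝ²ⁿ` as a complex-valued form. -/
def stdSympC (n : ℕ) : R2n n [⋀^Fin 2]→ₗ[ℝ] ℂ := complexify (stdSymp n)

/-- Lagrangian subspaces of `ℝ²ⁿ`: isotropic subspaces of dimension `n`. -/
def IsLagrangian {n : ℕ} (L : Submodule ℝ (R2n n)) : Prop :=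
  Module.finrank ℝ L = n ∧ ∀ u ∈ L, ∀ v ∈ L, stdSymp n ![u, v] = 0

/-- The Lagrangian Grassmannian of `ℝ²ⁿ`. -/
abbrev LGr (n : ℕ) : Type := {L : Submodule ℝ (R2n n) // IsLagrangian L}

/-- `𝒰(n)`: the complex-valued alternating `n`-forms on `ℝ²ⁿ` that are primitive and whose
restriction to every Lagrangian subspace is non-zero. -/
def U (n : ℕ) : Set (R2n n [⋀^Fin n]→ₗ[ℝ] ℂ) :=
  {Ω | wedge (stdSympC n) Ω = 0 ∧
    ∀ L : Submodule ℝ (R2n n), IsLagrangian L → Ω.compLinearMap L.subtype ≠ 0}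

/-- A basis of a Lagrangian subspace. -/
def lagBasis {n : ℕ} (L : LGr n) : Module.Basis (Fin n) ℝ L.1 :=
  have : Module.Finite ℝ L.1 := inferInstance
  Module.finBasisOfFinrankEq ℝ L.1 L.2.1

/-- The phase map `φ_Ω : LGr(n) → ℝ/πℤ`, `L ↦ Arg(Ω|_L)`, where `Ω|_L` is regarded as a complex
number by evaluating it on a basis of `L`. By `phase_eq` below the choice of basis is
irrelevant. -/
def phase {n : ℕ} (Ω : R2n n [⋀^Fin n]→ₗ[ℝ] ℂ) (L : LGr n) : AddCircle Real.pi :=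
  ((Complex.arg (Ω fun j => (lagBasis L j : R2n n)) : ℝ) : AddCircle Real.pi)

theorem arg_real_mul (r : ℝ) (hr : r ≠ 0) (z : ℂ) :
    ((Complex.arg (r * z) : ℝ) : AddCircle Real.pi) = ((Complex.arg z : ℝ) : AddCircle Real.pi) := by
  rcases eq_or_ne z 0 with rfl | hz
  · simp
  rcases lt_or_gt_of_ne hr with h | h
  · have h1 : (r : ℂ) * z = ((-r : ℝ) : ℂ) * (-z) := by push_cast; ring
    rw [h1, Complex.arg_real_mul _ (by linarith)]
    have h2 := Complex.arg_neg_coe_angle hz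
    have h3 : ((Complex.arg (-z) : ℝ) : Real.Angle) = ((z.arg + Real.pi : ℝ) : Real.Angle) := by
      rw [h2]; rfl
    obtain ⟨k, hk⟩ := Real.Angle.angle_eq_iff_two_pi_dvd_sub.1 h3
    have h4 : (-z).arg = z.arg + ((2 * k + 1 : ℤ) : ℝ) * Real.pi := by
      push_cast; linarith
    rw [h4, AddCircle.coe_add, ← zsmul_eq_mul, AddCircle.coe_zsmul, AddCircle.coe_period]
    simp
  · rw [Complex.arg_real_mul _ h]

/-- The phase may be computed with any basis of the Lagrangian subspace. -/
theorem phase_eq {n : ℕ} (Ω : R2n n [⋀^Fin n]→ₗ[ℝ] ℂ) (L : LGr n)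
    (b : Module.Basis (Fin n) ℝ L.1) :
    phase Ω L = ((Complex.arg (Ω fun j => (b j : R2n n)) : ℝ) : AddCircle Real.pi) := by
  have key : ((lagBasis L).det b : ℝ) • (Ω fun j => (lagBasis L j : R2n n))
      = Ω fun j => (b j : R2n n) := by
    have h : Ω.compLinearMap L.1.subtype
        = (LinearMap.toSpanSingleton ℝ ℂ (Ω fun j => (lagBasis L j : R2n n))).compAlternatingMap
            (lagBasis L).det := by
      refine Module.Basis.ext_alternating (lagBasis L) fun v hv => ?_
      let e : Equiv.Perm (Fin n) := Equiv.ofBijective v (Finite.injective_iff_bijective.1 hv)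
      have h1 := (Ω.compLinearMap L.1.subtype).map_perm (fun j => lagBasis L j) e
      have h2 := (lagBasis L).det.map_perm (fun j => lagBasis L j) e
      have h3 : (fun i => lagBasis L (v i)) = (fun j => lagBasis L j) ∘ e := rfl
      rw [h3, h1, LinearMap.compAlternatingMap_apply, h2, Module.Basis.det_self]
      rcases Int.units_eq_one_or (Equiv.Perm.sign e) with hs | hs <;> rw [hs] <;> simp
    have h' := congrArg (fun f => f (fun j => b j)) h
    exact h'.symm
  have hne : (lagBasis L).det b ≠ 0 := (Module.Basis.isUnit_det (lagBasis L) b).ne_zero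
  rw [← key, phase, Complex.real_smul, arg_real_mul _ hne]

/-- The injective linear map `ℝⁿ → ℝ²ⁿ = ℂⁿ`, `r ↦ (e^{iθ} r₁, r₂, …, rₙ)`. -/
def loopMap (n : ℕ) (θ : ℝ) : (Fin n → ℝ) →ₗ[ℝ] R2n n where
  toFun r := (fun j => if (j : ℕ) = 0 then Real.cos θ * r j else r j,
    fun j => if (j : ℕ) = 0 then Real.sin θ * r j else 0)
  map_add' r s := by
    ext j <;> by_cases h : (j : ℕ) = 0 <;> simp [h] <;> ring
  map_smul' c r := by
    ext j <;> by_cases h : (j : ℕ) = 0 <;> simp [h] <;> ring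

theorem loopMap_injective (n : ℕ) (θ : ℝ) : Function.Injective (loopMap n θ) := by
  rw [injective_iff_map_eq_zero]
  intro r hr
  ext j
  have h1 := congrFun (congrArg Prod.fst hr) j
  have h2 := congrFun (congrArg Prod.snd hr) j
  by_cases h : (j : ℕ) = 0
  · simp only [loopMap, LinearMap.coe_mk, AddHom.coe_mk, h, if_true, Prod.fst_zero,
      Prod.snd_zero, Pi.zero_apply] at h1 h2 ⊢
    have := Real.sin_sq_add_cos_sq θ
    have h3 : r j = Real.sin θ * (Real.sin θ * r j) + Real.cos θ * (Real.cos θ * r j) := by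
      linear_combination (-(r j)) * this
    rw [h3, h1, h2]; simp
  · simpa [loopMap, h] using h1

theorem isLagrangian_loop (n : ℕ) (θ : ℝ) : IsLagrangian (LinearMap.range (loopMap n θ)) := by
  refine ⟨?_, ?_⟩
  · rw [LinearMap.finrank_range_of_inj (loopMap_injective n θ)]; simp
  · rintro _ ⟨r, rfl⟩ _ ⟨s, rfl⟩
    rw [stdSymp_apply]
    refine Finset.sum_eq_zero fun j _ => ?_
    by_cases h : (j : ℕ) = 0
    · simp [loopMap, h]; ring
    · simp [loopMap, h]

/-- The Lagrangian subspace `e^{iθ}ℝ × ℝⁿ⁻¹` of `ℂⁿ = ℝ²ⁿ`. -/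
def loopLag (n : ℕ) (θ : ℝ) : LGr n :=
  ⟨LinearMap.range (loopMap n θ), isLagrangian_loop n θ⟩

theorem loopLag_periodic (n : ℕ) : Function.Periodic (loopLag n) Real.pi := by
  have key : ∀ θ : ℝ, LinearMap.range (loopMap n (θ + Real.pi)) ≤ LinearMap.range (loopMap n θ) ∧
      LinearMap.range (loopMap n θ) ≤ LinearMap.range (loopMap n (θ + Real.pi)) := by
    intro θ
    constructor <;>
    · rintro _ ⟨r, rfl⟩
      refine ⟨fun j => if (j : ℕ) = 0 then - r j else r j, ?_⟩
      ext j <;> by_cases h : (j : ℕ) = 0 <;>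
        simp [loopMap, h, Real.cos_add_pi, Real.sin_add_pi]
  intro θ
  exact Subtype.ext (le_antisymm (key θ).1 (key θ).2)

/-- The loop `ℝ/πℤ → LGr(n)`, `θ ↦ e^{iθ}ℝ × ℝⁿ⁻¹`, which represents the canonical generator of
`π₁(LGr(n)) ≅ ℤ` when `n > 0`. -/
def canonicalLoop (n : ℕ) : AddCircle Real.pi → LGr n := (loopLag_periodic n).lift

/-- The loop `f : ℝ/πℤ → ℝ/πℤ` is continuous of degree `d`, i.e. it lifts to a continuous
`g : ℝ → ℝ` with `g (t + π) = g t + d π`. Equivalently its class in `π₁(ℝ/πℤ) ≅ ℤ` is `d`. -/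
def HasDegree (f : AddCircle Real.pi → AddCircle Real.pi) (d : ℤ) : Prop :=
  ∃ g : ℝ → ℝ, Continuous g ∧ (∀ t : ℝ, ((g t : ℝ) : AddCircle Real.pi) = f (t : AddCircle Real.pi)) ∧
    ∀ t : ℝ, g (t + Real.pi) = g t + d * Real.pi

/-- `𝒰⁺(n)`: the forms in `𝒰(n)` whose phase map sends the canonical generator of `π₁(LGr(n))` to
a positive element of `π₁(ℝ/πℤ) ≅ ℤ`. -/
def UPlus (n : ℕ) : Set (R2n n [⋀^Fin n]→ₗ[ℝ] ℂ) :=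
  {Ω | Ω ∈ U n ∧ ∃ d : ℤ, 0 < d ∧ HasDegree (phase Ω ∘ canonicalLoop n) d}

/-- `𝒰⁻(n)`: the forms in `𝒰(n)` whose phase map sends the canonical generator of `π₁(LGr(n))` to
a negative element of `π₁(ℝ/πℤ) ≅ ℤ`. -/
def UMinus (n : ℕ) : Set (R2n n [⋀^Fin n]→ₗ[ℝ] ℂ) :=
  {Ω | Ω ∈ U n ∧ ∃ d : ℤ, d < 0 ∧ HasDegree (phase Ω ∘ canonicalLoop n) d}

end LagrangianForms

end

open scoped ComplexConjugate Matrix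

noncomputable section

/-! Write `a` for the value of Ω on the frame `e` of x-directions, and `B i j` for its value when `e
i` is replaced by `f j`. Primitivity makes `B` symmetric (`mixedCoeff_symm`). Non-vanishing on
Lagrangians keeps the real quadratic form `P = Im (conj a · B)` away from zero on vectors with first
coordinate 1, so `P 0 0 > 0` forces `P ≥ 0` (`quadratic_nonneg`). A shear removes `Re (conj a · B)`
and an orthogonal change of basis diagonalises `P`: in the resulting symplectic frame the
off-diagonal mixed coefficients vanish and Ω has positive orientation in each coordinate plane
(`exists_diagonal_frame`).

In such a frame Ω ∧ conj Ω involves only the eight coefficients of Ω on triples with one vector from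
each coordinate plane. They form a trilinear form on (ℝ²)³ which has no zeros, since a product of
three lines is Lagrangian. The Cayley substitution `(x, y) = (1 + w, -i(1 - w))` turns it into a
tri-affine polynomial without zeros on the torus; positive orientation pushes this to the closed
tridisc (`triEval_norm_lt`). Asano contraction then makes the alternating sum of squared moduli of
its coefficients positive (`alternating_normSq_pos`). This sum is -16 times the pairing that
computes i Ω ∧ conj Ω, which gives the sign.

The sign of `P 0 0`, which is never zero, is the degree of the phase along the canonical loop: that
loop traces the argument of the ellipse `cos t · a + sin t · B 0 0`. The negative case follows by
conjugating Ω. -/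

namespace LagrangianForms

/-! ### Wedge products as explicit sums over shuffles. -/

section Shuffles

open Equiv Equiv.Perm

theorem card_modSumCongr (p q : ℕ) :
    Fintype.card (ModSumCongr (Fin p) (Fin q)) * (p.factorial * q.factorial)
      = (p + q).factorial := by
  have h := Subgroup.card_eq_card_quotient_mul_card_subgroup
    (sumCongrHom (Fin p) (Fin q)).range
  have h2 : Nat.card (sumCongrHom (Fin p) (Fin q)).range = p.factorial * q.factorial := by
    rw [← Nat.card_congr (MonoidHom.ofInjective sumCongrHom_injective).toEquiv]
    simp [Nat.card_eq_fintype_card, Fintype.card_perm]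
  rw [h2, Nat.card_eq_fintype_card, Nat.card_eq_fintype_card] at h
  rw [← h]
  simp [Fintype.card_perm]

/-- A wedge product as a signed sum over explicit representatives of the `(p,q)`-shuffles. -/
theorem wedge_eq_sum {V A : Type*} [AddCommGroup V] [Module ℝ V] [CommRing A] [Algebra ℝ A]
    {p q : ℕ} (α : V [⋀^Fin p]→ₗ[ℝ] A) (β : V [⋀^Fin q]→ₗ[ℝ] A) {N : ℕ}
    (σ : Fin N → Perm (Fin p ⊕ Fin q)) (ε : Fin N → ℤ)
    (a : Fin N → Fin p → Fin (p + q)) (b : Fin N → Fin q → Fin (p + q))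
    (hN : N * (p.factorial * q.factorial) = (p + q).factorial)
    (hε : ∀ i, (sign (σ i) : ℤ) = ε i)
    (ha : ∀ i k, finSumFinEquiv (σ i (Sum.inl k)) = a i k)
    (hb : ∀ i k, finSumFinEquiv (σ i (Sum.inr k)) = b i k)
    (hinj : ∀ i j, i ≠ j → ∃ k, ∀ l, a i k ≠ a j l) (v : Fin (p + q) → V) :
    wedge α β v = ∑ i, ε i • (α (fun k => v (a i k)) * β (fun k => v (b i k))) := by
  let f : Fin N → ModSumCongr (Fin p) (Fin q) := fun i => Quotient.mk'' (σ i)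
  -- Permutations in one coset send the left block to the same set, so an entry of `a i` missing
  -- from `a j` separates the cosets. The cardinality `hN` then shows that every coset is
  -- represented.
  have hf : Function.Injective f := by
    intro i j hij
    by_contra hne
    obtain ⟨k, hk⟩ := hinj i j hne
    have h1 := QuotientGroup.leftRel_apply.mp (Quotient.exact' hij)
    obtain ⟨⟨sl, sr⟩, hs⟩ := h1
    have h2 : σ j = σ i * sumCongrHom _ _ (sl, sr) := by rw [hs]; simp
    apply hk (sl.symm k)
    rw [← ha, ← ha, h2]
    simp
  have hcard : Fintype.card (Fin N) = Fintype.card (ModSumCongr (Fin p) (Fin q)) := by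
    have h := card_modSumCongr p q
    rw [← hN] at h
    rw [Fintype.card_fin]
    exact (Nat.eq_of_mul_eq_mul_right (by positivity) h).symm
  have hbij : Function.Bijective f := (Fintype.bijective_iff_injective_and_card f).2 ⟨hf, hcard⟩
  have h0 : wedge α β v = LinearMap.mul' ℝ A
      (∑ s : ModSumCongr (Fin p) (Fin q),
        AlternatingMap.domCoprod.summand α β s (fun i => v (finSumFinEquiv i))) := by
    simp [wedge, AlternatingMap.domCoprod_apply, Function.comp_def]
  rw [h0, ← Function.Bijective.sum_comp hbij, map_sum]
  refine Finset.sum_congr rfl fun i _ => ?_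
  simp only [f, AlternatingMap.domCoprod.summand_mk'']
  rw [← hε i, Units.smul_def, _root_.smul_apply, map_zsmul]
  simp [MultilinearMap.domDomCongr_apply, MultilinearMap.domCoprod_apply, ha, hb]

/-- The product of the transpositions exchanging the given positions of the two summands. -/
def swaps {p q : ℕ} (l : List (Fin p × Fin q)) : Perm (Fin p ⊕ Fin q) :=
  (l.map fun x => swap (Sum.inl x.1) (Sum.inr x.2)).prod

theorem sign_swaps {p q : ℕ} (l : List (Fin p × Fin q)) :
    (sign (swaps l) : ℤ) = (-1) ^ l.length := by
  induction l with
  | nil => simp [swaps]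
  | cons x l ih =>
    have h : swaps (x :: l) = swap (Sum.inl x.1) (Sum.inr x.2) * swaps l := by simp [swaps]
    rw [h, Perm.sign_mul, sign_swap (by simp), Units.val_mul, ih]
    simp [pow_succ]

end Shuffles

theorem comp_vec_two {X Y : Type*} (v : X → Y) (a b : X) :
    (fun k => v (![a, b] k)) = ![v a, v b] := by
  ext k; fin_cases k <;> rfl

theorem comp_vec_three {X Y : Type*} (v : X → Y) (a b c : X) :
    (fun k => v (![a, b, c] k)) = ![v a, v b, v c] := by
  ext k; fin_cases k <;> rfl

theorem comp_vec_four {X Y : Type*} (v : X → Y) (a b c d : X) :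
    (fun k => v (![a, b, c, d] k)) = ![v a, v b, v c, v d] := by
  ext k; fin_cases k <;> rfl

section ExplicitShuffles

set_option maxRecDepth 10000

/-- The wedge product of a `2`-form and a `2`-form as a sum over shuffles. -/
theorem wedge_two_two {V : Type*} [AddCommGroup V] [Module ℝ V]
    (α : V [⋀^Fin 2]→ₗ[ℝ] ℂ) (β : V [⋀^Fin 2]→ₗ[ℝ] ℂ) (v : Fin (2 + 2) → V) :
    wedge α β v =
      α ![v 0, v 1] * β ![v 2, v 3]
      - α ![v 2, v 1] * β ![v 0, v 3]
      - α ![v 3, v 1] * β ![v 2, v 0]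
      - α ![v 0, v 2] * β ![v 1, v 3]
      - α ![v 0, v 3] * β ![v 2, v 1]
      + α ![v 2, v 3] * β ![v 0, v 1] := by
  rw [wedge_eq_sum α β (fun i => swaps ((![[], [(0, 0)], [(0, 1)], [(1, 0)], [(1, 1)], [(0, 0), (1, 1)]] :
      Fin 6 → List (Fin 2 × Fin 2)) i))
    ![1, -1, -1, -1, -1, 1]
    ![![0, 1], ![2, 1], ![3, 1], ![0, 2], ![0, 3], ![2, 3]]
    ![![2, 3], ![0, 3], ![2, 0], ![1, 3], ![2, 1], ![0, 1]]
    (by decide) (fun i => by rw [sign_swaps]; revert i; decide) (by decide) (by decide)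
    (by decide) v]
  simp [Fin.sum_univ_succ, comp_vec_two]
  ring

/-- The wedge product of a `2`-form and a `3`-form as a sum over shuffles. -/
theorem wedge_two_three {V : Type*} [AddCommGroup V] [Module ℝ V]
    (α : V [⋀^Fin 2]→ₗ[ℝ] ℂ) (β : V [⋀^Fin 3]→ₗ[ℝ] ℂ) (v : Fin (2 + 3) → V) :
    wedge α β v =
      α ![v 0, v 1] * β ![v 2, v 3, v 4]
      - α ![v 2, v 1] * β ![v 0, v 3, v 4]
      - α ![v 3, v 1] * β ![v 2, v 0, v 4]
      - α ![v 4, v 1] * β ![v 2, v 3, v 0]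
      - α ![v 0, v 2] * β ![v 1, v 3, v 4]
      - α ![v 0, v 3] * β ![v 2, v 1, v 4]
      - α ![v 0, v 4] * β ![v 2, v 3, v 1]
      + α ![v 2, v 3] * β ![v 0, v 1, v 4]
      + α ![v 2, v 4] * β ![v 0, v 3, v 1]
      + α ![v 3, v 4] * β ![v 2, v 0, v 1] := by
  rw [wedge_eq_sum α β (fun i => swaps ((![[], [(0, 0)], [(0, 1)], [(0, 2)], [(1, 0)], [(1, 1)], [(1, 2)],
      [(0, 0), (1, 1)], [(0, 0), (1, 2)], [(0, 1), (1, 2)]] :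
      Fin 10 → List (Fin 2 × Fin 3)) i))
    ![1, -1, -1, -1, -1, -1, -1, 1, 1, 1]
    ![![0, 1], ![2, 1], ![3, 1], ![4, 1], ![0, 2], ![0, 3], ![0, 4], ![2, 3],
      ![2, 4], ![3, 4]]
    ![![2, 3, 4], ![0, 3, 4], ![2, 0, 4], ![2, 3, 0], ![1, 3, 4], ![2, 1, 4],
      ![2, 3, 1], ![0, 1, 4], ![0, 3, 1], ![2, 0, 1]]
    (by decide) (fun i => by rw [sign_swaps]; revert i; decide) (by decide) (by decide)
    (by decide) v]
  simp [Fin.sum_univ_succ, comp_vec_two, comp_vec_three]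
  ring

/-- The wedge product of a `4`-form and a `2`-form as a sum over shuffles. -/
theorem wedge_four_two {V : Type*} [AddCommGroup V] [Module ℝ V]
    (α : V [⋀^Fin 4]→ₗ[ℝ] ℂ) (β : V [⋀^Fin 2]→ₗ[ℝ] ℂ) (v : Fin (4 + 2) → V) :
    wedge α β v =
      α ![v 0, v 1, v 2, v 3] * β ![v 4, v 5]
      - α ![v 4, v 1, v 2, v 3] * β ![v 0, v 5]
      - α ![v 5, v 1, v 2, v 3] * β ![v 4, v 0]
      - α ![v 0, v 4, v 2, v 3] * β ![v 1, v 5]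
      - α ![v 0, v 5, v 2, v 3] * β ![v 4, v 1]
      - α ![v 0, v 1, v 4, v 3] * β ![v 2, v 5]
      - α ![v 0, v 1, v 5, v 3] * β ![v 4, v 2]
      - α ![v 0, v 1, v 2, v 4] * β ![v 3, v 5]
      - α ![v 0, v 1, v 2, v 5] * β ![v 4, v 3]
      + α ![v 4, v 5, v 2, v 3] * β ![v 0, v 1]
      + α ![v 4, v 1, v 5, v 3] * β ![v 0, v 2]
      + α ![v 4, v 1, v 2, v 5] * β ![v 0, v 3]
      + α ![v 0, v 4, v 5, v 3] * β ![v 1, v 2]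
      + α ![v 0, v 4, v 2, v 5] * β ![v 1, v 3]
      + α ![v 0, v 1, v 4, v 5] * β ![v 2, v 3] := by
  rw [wedge_eq_sum α β (fun i => swaps ((![[], [(0, 0)], [(0, 1)], [(1, 0)], [(1, 1)], [(2, 0)], [(2, 1)], [(3, 0)],
      [(3, 1)], [(0, 0), (1, 1)], [(0, 0), (2, 1)], [(0, 0), (3, 1)],
      [(1, 0), (2, 1)], [(1, 0), (3, 1)], [(2, 0), (3, 1)]] :
      Fin 15 → List (Fin 4 × Fin 2)) i))
    ![1, -1, -1, -1, -1, -1, -1, -1, -1, 1, 1, 1, 1, 1, 1]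
    ![![0, 1, 2, 3], ![4, 1, 2, 3], ![5, 1, 2, 3], ![0, 4, 2, 3], ![0, 5, 2, 3],
      ![0, 1, 4, 3], ![0, 1, 5, 3], ![0, 1, 2, 4], ![0, 1, 2, 5], ![4, 5, 2, 3],
      ![4, 1, 5, 3], ![4, 1, 2, 5], ![0, 4, 5, 3], ![0, 4, 2, 5], ![0, 1, 4, 5]]
    ![![4, 5], ![0, 5], ![4, 0], ![1, 5], ![4, 1], ![2, 5], ![4, 2], ![3, 5],
      ![4, 3], ![0, 1], ![0, 2], ![0, 3], ![1, 2], ![1, 3], ![2, 3]]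
    (by decide) (fun i => by rw [sign_swaps]; revert i; decide) (by decide) (by decide)
    (by decide) v]
  simp [Fin.sum_univ_succ, comp_vec_two, comp_vec_four]
  ring

/-- The wedge product of a `3`-form and a `3`-form as a sum over shuffles. -/
theorem wedge_three_three {V : Type*} [AddCommGroup V] [Module ℝ V]
    (α : V [⋀^Fin 3]→ₗ[ℝ] ℂ) (β : V [⋀^Fin 3]→ₗ[ℝ] ℂ) (v : Fin (3 + 3) → V) :
    wedge α β v =
      α ![v 0, v 1, v 2] * β ![v 3, v 4, v 5]
      - α ![v 3, v 1, v 2] * β ![v 0, v 4, v 5]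
      - α ![v 4, v 1, v 2] * β ![v 3, v 0, v 5]
      - α ![v 5, v 1, v 2] * β ![v 3, v 4, v 0]
      - α ![v 0, v 3, v 2] * β ![v 1, v 4, v 5]
      - α ![v 0, v 4, v 2] * β ![v 3, v 1, v 5]
      - α ![v 0, v 5, v 2] * β ![v 3, v 4, v 1]
      - α ![v 0, v 1, v 3] * β ![v 2, v 4, v 5]
      - α ![v 0, v 1, v 4] * β ![v 3, v 2, v 5]
      - α ![v 0, v 1, v 5] * β ![v 3, v 4, v 2]
      + α ![v 3, v 4, v 2] * β ![v 0, v 1, v 5]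
      + α ![v 3, v 5, v 2] * β ![v 0, v 4, v 1]
      + α ![v 4, v 5, v 2] * β ![v 3, v 0, v 1]
      + α ![v 3, v 1, v 4] * β ![v 0, v 2, v 5]
      + α ![v 3, v 1, v 5] * β ![v 0, v 4, v 2]
      + α ![v 4, v 1, v 5] * β ![v 3, v 0, v 2]
      + α ![v 0, v 3, v 4] * β ![v 1, v 2, v 5]
      + α ![v 0, v 3, v 5] * β ![v 1, v 4, v 2]
      + α ![v 0, v 4, v 5] * β ![v 3, v 1, v 2]
      - α ![v 3, v 4, v 5] * β ![v 0, v 1, v 2] := by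
  rw [wedge_eq_sum α β (fun i => swaps ((![[], [(0, 0)], [(0, 1)], [(0, 2)], [(1, 0)], [(1, 1)], [(1, 2)], [(2, 0)],
      [(2, 1)], [(2, 2)], [(0, 0), (1, 1)], [(0, 0), (1, 2)], [(0, 1), (1, 2)],
      [(0, 0), (2, 1)], [(0, 0), (2, 2)], [(0, 1), (2, 2)], [(1, 0), (2, 1)],
      [(1, 0), (2, 2)], [(1, 1), (2, 2)], [(0, 0), (1, 1), (2, 2)]] :
      Fin 20 → List (Fin 3 × Fin 3)) i))
    ![1, -1, -1, -1, -1, -1, -1, -1, -1, -1, 1, 1, 1, 1, 1, 1, 1, 1, 1, -1]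
    ![![0, 1, 2], ![3, 1, 2], ![4, 1, 2], ![5, 1, 2], ![0, 3, 2], ![0, 4, 2],
      ![0, 5, 2], ![0, 1, 3], ![0, 1, 4], ![0, 1, 5], ![3, 4, 2], ![3, 5, 2],
      ![4, 5, 2], ![3, 1, 4], ![3, 1, 5], ![4, 1, 5], ![0, 3, 4], ![0, 3, 5],
      ![0, 4, 5], ![3, 4, 5]]
    ![![3, 4, 5], ![0, 4, 5], ![3, 0, 5], ![3, 4, 0], ![1, 4, 5], ![3, 1, 5],
      ![3, 4, 1], ![2, 4, 5], ![3, 2, 5], ![3, 4, 2], ![0, 1, 5], ![0, 4, 1],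
      ![3, 0, 1], ![0, 2, 5], ![0, 4, 2], ![3, 0, 2], ![1, 2, 5], ![1, 4, 2],
      ![3, 1, 2], ![0, 1, 2]]
    (by decide) (fun i => by rw [sign_swaps]; revert i; decide) (by decide) (by decide)
    (by decide) v]
  simp [Fin.sum_univ_succ, comp_vec_three]
  ring

end ExplicitShuffles

/-! ### Asano contraction and polynomials without zeros in polydiscs. -/

/-- Asano contraction of a bi-affine polynomial without zeros in the closed bidisc. -/
theorem norm_lt_of_biaffine_ne_zero {a b c d : ℂ}
    (h : ∀ z w : ℂ, ‖z‖ ≤ 1 → ‖w‖ ≤ 1 → a + b * z + c * w + d * (z * w) ≠ 0) : ‖d‖ < ‖a‖ := by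
  by_contra! hle
  have ha : a ≠ 0 := by simpa using h 0 0 (by simp) (by simp)
  have hd : d ≠ 0 := by
    rintro rfl
    simp only [norm_zero, norm_le_zero_iff] at hle
    exact ha hle
  obtain ⟨s, hs⟩ := IsAlgClosed.exists_eq_mul_self (discrim d (b + c) a)
  obtain ⟨r, hr⟩ := exists_quadratic_eq_zero hd ⟨s, hs⟩
  -- Restrict to the diagonal `z = w`. By Vieta the second root is `-(b + c) / d - r`; both roots
  -- lie outside the closed disc, while their product `a / d` would have modulus at most 1.
  have hr' : d * (-(b + c) / d - r) * (-(b + c) / d - r) + (b + c) * (-(b + c) / d - r) + a = 0 := by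
    rw [← hr]; field_simp; ring
  have hprod : r * (-(b + c) / d - r) = a / d := by
    field_simp; linear_combination -hr
  have key : ∀ z : ℂ, d * (z * z) + (b + c) * z + a = 0 → 1 < ‖z‖ := by
    intro z hz
    by_contra! hz1
    exact h z z hz1 hz1 (by rw [← hz]; ring)
  have h1 := key r (by rw [← hr])
  have h2 := key (-(b + c) / d - r) (by linear_combination hr')
  have h3 : ‖r‖ * ‖-(b + c) / d - r‖ ≤ 1 := by
    rw [← norm_mul, hprod, norm_div]
    exact div_le_one_of_le₀ hle (norm_nonneg _)
  nlinarith

/-- If `f + g w` has no zero with `x ∈ X`, `‖w‖ = 1`, and `‖g‖ < ‖f‖` at one point of the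
connected set `X`, then `‖g‖ < ‖f‖` on all of `X`. -/
theorem norm_lt_of_affine_ne_zero {T : Type*} [TopologicalSpace T] {X : Set T}
    (hX : IsPreconnected X) {f g : T → ℂ} (hf : Continuous f) (hg : Continuous g)
    (h : ∀ x ∈ X, ∀ w : ℂ, ‖w‖ = 1 → f x + g x * w ≠ 0) {x₀ : T} (hx₀ : x₀ ∈ X)
    (h₀ : ‖g x₀‖ < ‖f x₀‖) : ∀ x ∈ X, ‖g x‖ < ‖f x‖ := by
  intro x hx
  by_contra! hle
  -- Where the two moduli agree, `w = -f / g` is a zero on the unit circle; if both vanish there,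
  -- any `w` is one.
  obtain ⟨y, hy, hy'⟩ := hX.intermediate_value₂ hx₀ hx (hg.norm.continuousOn)
    (hf.norm.continuousOn) h₀.le hle
  rcases eq_or_ne (g y) 0 with hg0 | hg0
  · have : f y = 0 := by rw [hg0, norm_zero] at hy'; exact norm_eq_zero.1 hy'.symm
    exact h y hy 1 (by simp) (by simp [this, hg0])
  · refine h y hy (-(f y / g y)) ?_ (by field_simp; ring)
    rw [norm_neg, norm_div, hy', div_self (by rw [← hy']; exact norm_ne_zero_iff.2 hg0)]

theorem affine_ne_zero {p q w : ℂ} (h : ‖q‖ < ‖p‖) (hw : ‖w‖ ≤ 1) : p + q * w ≠ 0 := by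
  intro h0
  have h1 : p = -(q * w) := by linear_combination h0
  have h2 : ‖p‖ ≤ ‖q‖ := by
    rw [h1, norm_neg, norm_mul]
    exact mul_le_of_le_one_right (norm_nonneg _) hw
  linarith

/-- A tri-affine polynomial without zeros in the closed tridisc: with `Q = p + q w₁` and
`p`, `q` bi-affine, the alternating sum of the squared moduli of the coefficients is positive. -/
theorem alternating_normSq_pos {p00 p10 p01 p11 q00 q10 q01 q11 : ℂ}
    (h : ∀ z w : ℂ, ‖z‖ ≤ 1 → ‖w‖ ≤ 1 →
      ‖q00 + q10 * z + q01 * w + q11 * (z * w)‖ < ‖p00 + p10 * z + p01 * w + p11 * (z * w)‖) :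
    0 < ‖p00‖ ^ 2 - ‖q00‖ ^ 2 - ‖p10‖ ^ 2 + ‖q10‖ ^ 2
      - ‖p01‖ ^ 2 + ‖q01‖ ^ 2 + ‖p11‖ ^ 2 - ‖q11‖ ^ 2 := by
  have hcc : ∀ z w : ℂ, ‖z‖ ≤ 1 → ‖w‖ ≤ 1 →
      ‖conj q00 + conj q10 * z + conj q01 * w + conj q11 * (z * w)‖
        < ‖conj p00 + conj p10 * z + conj p01 * w + conj p11 * (z * w)‖ := by
    intro z w hz hw
    have := h (conj z) (conj w) (by simpa using hz) (by simpa using hw)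
    rw [← Complex.norm_conj, ← Complex.norm_conj (p00 + _ + _ + _)] at this
    simpa using this
  -- coefficients of the contraction in the first variable
  have key : ∀ w u : ℂ, ‖w‖ ≤ 1 → ‖u‖ ≤ 1 →
      ‖(p10 + p11 * w) * (conj p10 + conj p11 * u) - (q10 + q11 * w) * (conj q10 + conj q11 * u)‖
      < ‖(p00 + p01 * w) * (conj p00 + conj p01 * u)
        - (q00 + q01 * w) * (conj q00 + conj q01 * u)‖ := by
    intro w u hw hu
    -- With `w`, `u` fixed, `p(z,w) · p̄(y,u) - q(z,w) · q̄(y,u)` is bi-affine in `z`, `y`, where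
    -- bars conjugate the coefficients. It has no zeros because the first product dominates in
    -- modulus.
    refine norm_lt_of_biaffine_ne_zero
      (b := (p10 + p11 * w) * (conj p00 + conj p01 * u) - (q10 + q11 * w) * (conj q00 + conj q01 * u))
      (c := (p00 + p01 * w) * (conj p10 + conj p11 * u) - (q00 + q01 * w) * (conj q10 + conj q11 * u))
      fun z y hz hy h0 => ?_
    have h1 := h z w hz hw
    have h2 := hcc y u hy hu
    have h3 := mul_lt_mul'' h1 h2 (norm_nonneg _) (norm_nonneg _)
    rw [← norm_mul, ← norm_mul] at h3
    refine h3.ne (congrArg norm ?_)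
    linear_combination -h0
  -- The constant coefficient minus the `zy`-coefficient is bi-affine in `w`, `u` and again without
  -- zeros, so it can be contracted a second time.
  have key2 := norm_lt_of_biaffine_ne_zero
    (a := (p00 * conj p00 - q00 * conj q00) - (p10 * conj p10 - q10 * conj q10))
    (b := (p01 * conj p00 - q01 * conj q00) - (p11 * conj p10 - q11 * conj q10))
    (c := (p00 * conj p01 - q00 * conj q01) - (p10 * conj p11 - q10 * conj q11))
    (d := (p01 * conj p01 - q01 * conj q01) - (p11 * conj p11 - q11 * conj q11))
    (fun w u hw hu h0 => (key w u hw hu).ne (congrArg norm (by linear_combination -h0)))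
  have k0 := key 0 0 (by simp) (by simp)
  have k1 := h 0 0 (by simp) (by simp)
  simp only [mul_zero, add_zero] at k0 k1
  have e : ∀ z : ℂ, z * conj z = ((‖z‖ ^ 2 : ℝ) : ℂ) := by
    intro z; rw [Complex.mul_conj, Complex.normSq_eq_norm_sq]
  simp only [e, ← Complex.ofReal_sub, Complex.norm_real, Real.norm_eq_abs] at key2 k0
  -- The contracted coefficients are real. Positivity of the leading one at each stage removes the
  -- absolute value on the larger side.
  have k2 : 0 < ‖p00‖ ^ 2 - ‖q00‖ ^ 2 := by nlinarith [norm_nonneg q00]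
  rw [abs_of_pos k2] at k0
  have k3 := (abs_lt.1 k0).2
  rw [abs_of_pos (sub_pos.2 k3)] at key2
  have := (abs_lt.1 key2).2
  linarith

/-! ### Trilinear forms on (ℝ²)³ without zeros. -/

/-- The value at complex arguments of the trilinear form on `(ℝ²)³` with coefficients `c`. -/
def triEval (c : Fin 2 → Fin 2 → Fin 2 → ℂ) (x y x' y' x'' y'' : ℂ) : ℂ :=
  c 0 0 0 * (x * x' * x'') + c 1 0 0 * (y * x' * x'') + c 0 1 0 * (x * y' * x'')
    + c 0 0 1 * (x * x' * y'') + c 1 1 0 * (y * y' * x'') + c 1 0 1 * (y * x' * y'')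
    + c 0 1 1 * (x * y' * y'') + c 1 1 1 * (y * y' * y'')

/-- With `w = s²` and `|s| = 1`, one has `1 + w = 2s · Re s` and `-i(1 - w) = -2s · Im s`. Hence the
Cayley substitution maps the unit circle to complex multiples of nonzero real points, and
homogeneity transfers non-vanishing. -/
theorem exists_circle_param {w : ℂ} (hw : ‖w‖ = 1) : ∃ (z : ℂ) (x y : ℝ), z ≠ 0 ∧
    (x, y) ≠ (0, 0) ∧ 1 + w = z * x ∧ -Complex.I * (1 - w) = z * y := by
  obtain ⟨s, hs⟩ := IsAlgClosed.exists_eq_mul_self w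
  have hs1 : s * conj s = 1 := by
    have h : ‖s‖ * ‖s‖ = 1 := by rw [← norm_mul, ← hs, hw]
    rw [Complex.mul_conj, Complex.normSq_eq_norm_sq, pow_two, h, Complex.ofReal_one]
  have hs0 : s ≠ 0 := by rintro rfl; simp at hs1
  refine ⟨2 * s, s.re, -s.im, by simpa using hs0, ?_, ?_, ?_⟩
  · intro h
    simp only [Prod.mk.injEq, neg_eq_zero] at h
    exact hs0 (Complex.ext h.1 h.2)
  · have : (2 : ℂ) * s.re = s + conj s := by rw [Complex.add_conj]; push_cast; ring
    linear_combination hs - hs1 - s * this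
  · have : (2 : ℂ) * s.im * Complex.I = s - conj s := by rw [Complex.sub_conj]; push_cast; ring
    have h2 : (2 : ℂ) * s.im = - Complex.I * (s - conj s) := by
      rw [← this]; linear_combination (2 * s.im : ℂ) * Complex.I_sq
    push_cast
    linear_combination Complex.I * hs + Complex.I * hs1 + s * h2

/-- The squared moduli differ by `4 Im (conj a · b)`. -/
theorem norm_add_I_mul_lt {a b : ℂ} (h : 0 < (conj a * b).im) :
    ‖a + Complex.I * b‖ < ‖a - Complex.I * b‖ := by
  apply lt_of_pow_lt_pow_left₀ 2 (norm_nonneg _)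
  rw [← Complex.normSq_eq_norm_sq, ← Complex.normSq_eq_norm_sq]
  simp [Complex.normSq_apply] at h ⊢
  nlinarith

/-- A trilinear form on `(ℝ²)³` without zeros, of positive degree in each variable, has no zeros
on the complexified tridisc. -/
theorem triEval_norm_lt (c : Fin 2 → Fin 2 → Fin 2 → ℂ)
    (h : ∀ x y x' y' x'' y'' : ℝ, (x, y) ≠ (0, 0) → (x', y') ≠ (0, 0) → (x'', y'') ≠ (0, 0) →
      triEval c x y x' y' x'' y'' ≠ 0)
    (h1 : 0 < (conj (c 0 0 0) * c 1 0 0).im) (h2 : 0 < (conj (c 0 0 0) * c 0 1 0).im)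
    (h3 : 0 < (conj (c 0 0 0) * c 0 0 1).im) (z w : ℂ) (hz : ‖z‖ ≤ 1) (hw : ‖w‖ ≤ 1) :
    ‖triEval c 1 Complex.I (1 + z) (-Complex.I * (1 - z)) (1 + w) (-Complex.I * (1 - w))‖
      < ‖triEval c 1 (-Complex.I) (1 + z) (-Complex.I * (1 - z)) (1 + w)
          (-Complex.I * (1 - w))‖ := by
  have hS : IsPreconnected (Metric.sphere (0 : ℂ) 1) :=
    isPreconnected_sphere (by rw [Complex.rank_real_complex]; norm_num) 0 1
  have hD : IsPreconnected (Metric.closedBall (0 : ℂ) 1) :=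
    (convex_closedBall 0 1).isPreconnected
  have n1 := norm_add_I_mul_lt h1
  have n2 := norm_add_I_mul_lt h2
  have n3 := norm_add_I_mul_lt h3
  have base : ∀ w₁ w₂ w₃ : ℂ, ‖w₁‖ = 1 → ‖w₂‖ = 1 → ‖w₃‖ = 1 →
      triEval c (1 + w₁) (-Complex.I * (1 - w₁)) (1 + w₂) (-Complex.I * (1 - w₂))
        (1 + w₃) (-Complex.I * (1 - w₃)) ≠ 0 := by
    intro w₁ w₂ w₃ hw₁ hw₂ hw₃
    obtain ⟨z₁, x₁, y₁, hz₁, hxy₁, e₁, f₁⟩ := exists_circle_param hw₁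
    obtain ⟨z₂, x₂, y₂, hz₂, hxy₂, e₂, f₂⟩ := exists_circle_param hw₂
    obtain ⟨z₃, x₃, y₃, hz₃, hxy₃, e₃, f₃⟩ := exists_circle_param hw₃
    rw [e₁, f₁, e₂, f₂, e₃, f₃]
    have : triEval c (z₁ * x₁) (z₁ * y₁) (z₂ * x₂) (z₂ * y₂) (z₃ * x₃) (z₃ * y₃)
        = z₁ * z₂ * z₃ * triEval c x₁ y₁ x₂ y₂ x₃ y₃ := by
      simp only [triEval]; ring
    rw [this]
    exact mul_ne_zero (mul_ne_zero (mul_ne_zero hz₁ hz₂) hz₃) (h _ _ _ _ _ _ hxy₁ hxy₂ hxy₃)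
  -- The base point of each connectedness argument has two variables equal to 1, where `(1 + w, -i(1
  -- - w)) = (2, 0)`; this produces a factor 4.
  have four : ∀ s t : ℂ, ‖s‖ < ‖t‖ → ‖4 * s‖ < ‖4 * t‖ := by
    intro s t hst
    rw [norm_mul, norm_mul]
    exact mul_lt_mul_of_pos_left hst (by simp)
  -- the third variable moves into the disc
  have s3 := norm_lt_of_affine_ne_zero (hS.prod hS)
    (f := fun p : ℂ × ℂ => triEval c (1 + p.1) (-Complex.I * (1 - p.1)) (1 + p.2)
      (-Complex.I * (1 - p.2)) 1 (-Complex.I))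
    (g := fun p : ℂ × ℂ => triEval c (1 + p.1) (-Complex.I * (1 - p.1)) (1 + p.2)
      (-Complex.I * (1 - p.2)) 1 Complex.I)
    (by unfold triEval; fun_prop) (by unfold triEval; fun_prop)
    (fun p hp w hw h0 => base p.1 p.2 w (by simpa using hp.1) (by simpa using hp.2) hw
      (by rw [← h0]; simp only [triEval]; ring))
    (x₀ := (1, 1)) (by simp)
    (by convert four _ _ n3 using 2 <;> (simp [triEval]; ring))
  -- Since `(1 + w, -i(1 - w)) = (1, -i) + w (1, i)`, the polynomial is affine in each variable.
  -- With the third variable already in the disc, the same argument now admits the second variable,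
  -- and afterwards the first.
  have s2 := norm_lt_of_affine_ne_zero (hS.prod hD)
    (f := fun p : ℂ × ℂ => triEval c (1 + p.1) (-Complex.I * (1 - p.1)) 1 (-Complex.I) (1 + p.2)
      (-Complex.I * (1 - p.2)))
    (g := fun p : ℂ × ℂ => triEval c (1 + p.1) (-Complex.I * (1 - p.1)) 1 Complex.I (1 + p.2)
      (-Complex.I * (1 - p.2)))
    (by unfold triEval; fun_prop) (by unfold triEval; fun_prop)
    (fun p hp w hw h0 => affine_ne_zero (s3 (p.1, w) ⟨hp.1, by simpa using hw⟩)
      (w := p.2) (by simpa using hp.2) (by rw [← h0]; simp only [triEval]; ring))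
    (x₀ := (1, 1)) (by simp)
    (by convert four _ _ n2 using 2 <;> (simp [triEval]; ring))
  have s1 := norm_lt_of_affine_ne_zero (hD.prod hD)
    (f := fun p : ℂ × ℂ => triEval c 1 (-Complex.I) (1 + p.1) (-Complex.I * (1 - p.1)) (1 + p.2)
      (-Complex.I * (1 - p.2)))
    (g := fun p : ℂ × ℂ => triEval c 1 Complex.I (1 + p.1) (-Complex.I * (1 - p.1)) (1 + p.2)
      (-Complex.I * (1 - p.2)))
    (by unfold triEval; fun_prop) (by unfold triEval; fun_prop)
    (fun p hp w hw h0 => affine_ne_zero (s2 (w, p.2) ⟨by simpa using hw, hp.2⟩)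
      (w := p.1) (by simpa using hp.1) (by rw [← h0]; simp only [triEval]; ring))
    (x₀ := (1, 1)) (by simp)
    (by convert four _ _ n1 using 2 <;> (simp [triEval]; ring))
  exact s1 (z, w) ⟨by simpa using hz, by simpa using hw⟩

/-- A trilinear form on `(ℝ²)³` without zeros and of positive degree in each variable pairs
negatively with its conjugate under the cube of the area form. -/
theorem tri_pairing_neg (c : Fin 2 → Fin 2 → Fin 2 → ℂ)
    (h : ∀ x y x' y' x'' y'' : ℝ, (x, y) ≠ (0, 0) → (x', y') ≠ (0, 0) → (x'', y'') ≠ (0, 0) →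
      triEval c x y x' y' x'' y'' ≠ 0)
    (h1 : 0 < (conj (c 0 0 0) * c 1 0 0).im) (h2 : 0 < (conj (c 0 0 0) * c 0 1 0).im)
    (h3 : 0 < (conj (c 0 0 0) * c 0 0 1).im) :
    (conj (c 0 0 0) * c 1 1 1).im - (conj (c 1 0 0) * c 0 1 1).im
      - (conj (c 0 1 0) * c 1 0 1).im - (conj (c 0 0 1) * c 1 1 0).im < 0 := by
  -- The coefficients of the tri-affine polynomial are the values of the trilinear form at the
  -- points `(1, ∓i)`. Their alternating sum of squared moduli is -16 times the pairing.
  have key := alternating_normSq_pos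
    (p00 := triEval c 1 (-Complex.I) 1 (-Complex.I) 1 (-Complex.I))
    (p10 := triEval c 1 (-Complex.I) 1 Complex.I 1 (-Complex.I))
    (p01 := triEval c 1 (-Complex.I) 1 (-Complex.I) 1 Complex.I)
    (p11 := triEval c 1 (-Complex.I) 1 Complex.I 1 Complex.I)
    (q00 := triEval c 1 Complex.I 1 (-Complex.I) 1 (-Complex.I))
    (q10 := triEval c 1 Complex.I 1 Complex.I 1 (-Complex.I))
    (q01 := triEval c 1 Complex.I 1 (-Complex.I) 1 Complex.I)
    (q11 := triEval c 1 Complex.I 1 Complex.I 1 Complex.I)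
    (fun z w hz hw => by
      convert triEval_norm_lt c h h1 h2 h3 z w hz hw using 2 <;> (simp only [triEval]; ring))
  simp only [← Complex.normSq_eq_norm_sq, triEval] at key
  simp [Complex.normSq_apply] at key
  simp
  linear_combination (1 / 16) * key

/-! ### Bases of Lagrangian subspaces. -/

/-- The standard symplectic form as a bilinear map. -/
def sympBil (n : ℕ) : R2n n →ₗ[ℝ] R2n n →ₗ[ℝ] ℝ :=
  LinearMap.mk₂ ℝ (fun u v => stdSymp n ![u, v])
    (fun u u' v => by
      simp only [stdSymp_apply, ← Finset.sum_add_distrib]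
      refine Finset.sum_congr rfl fun j _ => ?_
      simp; ring)
    (fun r u v => by
      simp only [stdSymp_apply, smul_eq_mul, Finset.mul_sum]
      refine Finset.sum_congr rfl fun j _ => ?_
      simp; ring)
    (fun u v v' => by
      simp only [stdSymp_apply, ← Finset.sum_add_distrib]
      refine Finset.sum_congr rfl fun j _ => ?_
      simp; ring)
    (fun r u v => by
      simp only [stdSymp_apply, smul_eq_mul, Finset.mul_sum]
      refine Finset.sum_congr rfl fun j _ => ?_
      simp; ring)

theorem stdSymp_eq_sympBil {n : ℕ} (u v : R2n n) : stdSymp n ![u, v] = sympBil n u v := rfl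

theorem sympBil_apply {n : ℕ} (u v : R2n n) :
    sympBil n u v = ∑ j, (u.1 j * v.2 j - u.2 j * v.1 j) := rfl

theorem sympBil_swap {n : ℕ} (u v : R2n n) : sympBil n v u = -sympBil n u v := by
  rw [sympBil_apply, sympBil_apply, ← Finset.sum_neg_distrib]
  exact Finset.sum_congr rfl fun j _ => by ring

theorem linearIndependent_of_pairing {ι : Type*} [Finite ι] {n : ℕ} {u d : ι → R2n n}
    (hd : ∀ i j, i ≠ j → sympBil n (u i) (d j) = 0) (hdd : ∀ i, sympBil n (u i) (d i) ≠ 0) :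
    LinearIndependent ℝ u := by
  have := Fintype.ofFinite ι
  rw [Fintype.linearIndependent_iff]
  intro g hg i
  have h := congrArg (fun x => sympBil n x (d i)) hg
  simp only [map_sum, LinearMap.sum_apply, map_smul, LinearMap.smul_apply, map_zero,
    LinearMap.zero_apply] at h
  rw [Finset.sum_eq_single i (fun j _ hj => by rw [hd j i hj, smul_zero]) (by simp)] at h
  exact (smul_eq_zero.1 h).resolve_right (hdd i)

/-- Top-degree forms are a one-dimensional space, so the value on one basis determines them. -/
theorem apply_eq_det_smul {ι V : Type*} [Fintype ι] [DecidableEq ι] [AddCommGroup V] [Module ℝ V]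
    (f : V [⋀^ι]→ₗ[ℝ] ℂ) (b : Module.Basis ι ℝ V) (v : ι → V) : f v = b.det v • f b := by
  have h : f = (LinearMap.toSpanSingleton ℝ ℂ (f b)).compAlternatingMap b.det := by
    refine Module.Basis.ext_alternating b fun v hv => ?_
    let e : Equiv.Perm ι := Equiv.ofBijective v (Finite.injective_iff_bijective.1 hv)
    have h1 := f.map_perm b e
    have h2 := b.det.map_perm b e
    have h3 : (fun i => b (v i)) = b ∘ e := rfl
    rw [h3, h1, LinearMap.compAlternatingMap_apply, h2, Module.Basis.det_self]
    rcases Int.units_eq_one_or (Equiv.Perm.sign e) with hs | hs <;> rw [hs] <;> simp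
  exact DFunLike.congr_fun h v

/-- A form in `𝒰(n)` does not vanish on a basis of a Lagrangian subspace. -/
theorem ne_zero_of_isotropic {n : ℕ} {Ω : R2n n [⋀^Fin n]→ₗ[ℝ] ℂ} (hΩ : Ω ∈ U n)
    {u d : Fin n → R2n n} (hu : ∀ i j, sympBil n (u i) (u j) = 0)
    (hd : ∀ i j, i ≠ j → sympBil n (u i) (d j) = 0) (hdd : ∀ i, sympBil n (u i) (d i) ≠ 0) :
    Ω u ≠ 0 := by
  have hli := linearIndependent_of_pairing hd hdd
  intro h0
  refine hΩ.2 (Submodule.span ℝ (Set.range u)) ⟨?_, ?_⟩ ?_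
  · rw [finrank_span_eq_card hli, Fintype.card_fin]
  · intro x hx y hy
    obtain ⟨a, rfl⟩ := (Submodule.mem_span_range_iff_exists_fun ℝ).1 hx
    obtain ⟨b, rfl⟩ := (Submodule.mem_span_range_iff_exists_fun ℝ).1 hy
    rw [stdSymp_eq_sympBil]
    simp [hu]
  · ext v
    rw [apply_eq_det_smul _ (Module.Basis.span hli)]
    simp [AlternatingMap.compLinearMap_apply, h0]

/-! ### Multilinear calculus for 3-forms. -/

section ThreeForms

theorem update_vec_zero {X : Type*} (a b c x : X) :
    Function.update ![a, b, c] 0 x = ![x, b, c] := by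
  ext1 i; fin_cases i <;> simp

theorem update_vec_one {X : Type*} (a b c x : X) :
    Function.update ![a, b, c] 1 x = ![a, x, c] := by
  ext1 i; fin_cases i <;> simp

theorem update_vec_two {X : Type*} (a b c x : X) :
    Function.update ![a, b, c] 2 x = ![a, b, x] := by
  ext1 i; fin_cases i <;> simp

variable {V : Type*} [AddCommGroup V] [Module ℝ V] (f : V [⋀^Fin 3]→ₗ[ℝ] ℂ)

theorem vec_add_fst (a a' b c : V) : f ![a + a', b, c] = f ![a, b, c] + f ![a', b, c] := by
  have h := f.map_update_add ![0, b, c] 0 a a'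
  simpa only [update_vec_zero] using h

theorem vec_smul_fst (r : ℝ) (a b c : V) : f ![r • a, b, c] = r * f ![a, b, c] := by
  have h := f.map_update_smul ![0, b, c] 0 r a
  simpa only [update_vec_zero, Complex.real_smul] using h

theorem vec_add_snd (a b b' c : V) : f ![a, b + b', c] = f ![a, b, c] + f ![a, b', c] := by
  have h := f.map_update_add ![a, 0, c] 1 b b'
  simpa only [update_vec_one] using h

theorem vec_smul_snd (r : ℝ) (a b c : V) : f ![a, r • b, c] = r * f ![a, b, c] := by
  have h := f.map_update_smul ![a, 0, c] 1 r b
  simpa only [update_vec_one, Complex.real_smul] using h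

theorem vec_add_thd (a b c c' : V) : f ![a, b, c + c'] = f ![a, b, c] + f ![a, b, c'] := by
  have h := f.map_update_add ![a, b, 0] 2 c c'
  simpa only [update_vec_two] using h

theorem vec_smul_thd (r : ℝ) (a b c : V) : f ![a, b, r • c] = r * f ![a, b, c] := by
  have h := f.map_update_smul ![a, b, 0] 2 r c
  simpa only [update_vec_two, Complex.real_smul] using h

theorem vec_eq_fst_snd (a c : V) : f ![a, a, c] = 0 :=
  f.map_eq_zero_of_eq _ (i := 0) (j := 1) rfl (by decide)

theorem vec_eq_fst_thd (a c : V) : f ![a, c, a] = 0 :=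
  f.map_eq_zero_of_eq _ (i := 0) (j := 2) rfl (by decide)

theorem vec_eq_snd_thd (a c : V) : f ![c, a, a] = 0 :=
  f.map_eq_zero_of_eq _ (i := 1) (j := 2) rfl (by decide)

theorem vec_swap_fst_snd (a b c : V) : f ![b, a, c] = -f ![a, b, c] := by
  have h := vec_eq_fst_snd f (a + b) c
  rw [vec_add_fst, vec_add_snd, vec_add_snd, vec_eq_fst_snd, vec_eq_fst_snd] at h
  linear_combination h

theorem vec_swap_snd_thd (a b c : V) : f ![a, c, b] = -f ![a, b, c] := by
  have h := vec_eq_snd_thd f (b + c) a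
  rw [vec_add_snd, vec_add_thd, vec_add_thd, vec_eq_snd_thd, vec_eq_snd_thd] at h
  linear_combination h

theorem eq_vec_three {X : Type*} (v : Fin 3 → X) : v = ![v 0, v 1, v 2] := by
  ext1 i; fin_cases i <;> rfl

/-- Translating all arguments of a `3`-form along one vector. -/
theorem apply_add_smul (e : Fin 3 → V) (c : Fin 3 → ℝ) (X : V) :
    f (fun m => e m + c m • X) = f e + ∑ m, c m * f (Function.update e m X) := by
  rw [eq_vec_three e, Fin.sum_univ_three, update_vec_zero, update_vec_one, update_vec_two,
    eq_vec_three (fun m => _ + c m • X)]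
  simp only [vec_add_fst, vec_add_snd, vec_add_thd, vec_smul_fst, vec_smul_snd, vec_smul_thd,
    vec_eq_fst_snd, vec_eq_fst_thd, vec_eq_snd_thd]
  simp
  ring

end ThreeForms

/-! ### Symplectic frames and primitivity. -/

/-- The coordinate vectors in the `x`-directions. -/
def stdE (n : ℕ) (i : Fin n) : R2n n := (Pi.single i 1, 0)

/-- The coordinate vectors in the `y`-directions. -/
def stdF (n : ℕ) (i : Fin n) : R2n n := (0, Pi.single i 1)

/-- The vectors `E`, `F` form a symplectic basis. -/
structure IsSymplecticFrame {n : ℕ} (E F : Fin n → R2n n) : Prop where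
  left : ∀ i j, sympBil n (E i) (E j) = 0
  right : ∀ i j, sympBil n (F i) (F j) = 0
  pair : ∀ i j, sympBil n (E i) (F j) = if i = j then 1 else 0

theorem IsSymplecticFrame.pair' {n : ℕ} {E F : Fin n → R2n n} (h : IsSymplecticFrame E F)
    (i j : Fin n) : sympBil n (F i) (E j) = if i = j then -1 else 0 := by
  rw [sympBil_swap, h.pair]
  split_ifs <;> simp_all

theorem isSymplecticFrame_std (n : ℕ) : IsSymplecticFrame (stdE n) (stdF n) where
  left i j := by simp [sympBil_apply, stdE]
  right i j := by simp [sympBil_apply, stdF]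
  pair i j := by simp [sympBil_apply, stdE, stdF, Pi.single_apply, eq_comm]

/-- If the imaginary part vanished, `-Re (conj a · b) · a + |a|² · b = 0` would be a real relation.
-/
theorem im_ne_zero_of_independent {a b : ℂ}
    (h : ∀ x y : ℝ, (x, y) ≠ (0, 0) → (x : ℂ) * a + y * b ≠ 0) : (conj a * b).im ≠ 0 := by
  intro h0
  have ha : a ≠ 0 := by simpa using h 1 0 (by simp)
  refine h (-(conj a * b).re) (Complex.normSq a) (by simp [ha]) ?_
  have h1 : ((conj a * b).re : ℂ) = conj a * b := by
    apply Complex.ext <;> simp only [Complex.ofReal_re, Complex.ofReal_im, h0]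
  rw [Complex.ofReal_neg, h1, Complex.normSq_eq_conj_mul_self]
  ring

/-- The value on vectors of the coordinate planes of a symplectic frame. -/
theorem frame_apply_ne_zero {n : ℕ} {Ω : R2n n [⋀^Fin n]→ₗ[ℝ] ℂ} (hΩ : Ω ∈ U n)
    {E F : Fin n → R2n n} (h : IsSymplecticFrame E F) (x y : Fin n → ℝ)
    (hxy : ∀ i, (x i, y i) ≠ (0, 0)) : Ω (fun i => x i • E i + y i • F i) ≠ 0 := by
  -- The quarter-turned vector in each coordinate plane is dual: the pairing is `x i ² + y i ²`.
  refine ne_zero_of_isotropic hΩ (d := fun i => x i • F i - y i • E i) ?_ ?_ ?_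
  · intro i j
    simp only [map_add, map_smul, LinearMap.add_apply, LinearMap.smul_apply, h.left, h.right,
      h.pair, h.pair', smul_eq_mul]
    split_ifs with hij
    · subst hij; ring
    · ring
  · intro i j hij
    simp [h.left, h.right, h.pair, h.pair', hij]
  · intro i
    have : x i ≠ 0 ∨ y i ≠ 0 := by
      by_contra! hc
      exact hxy i (by rw [hc.1, hc.2])
    simp [h.left, h.right, h.pair, h.pair']
    intro h0
    rcases this with hx | hy
    · nlinarith [mul_self_pos.2 hx, mul_self_nonneg (y i)]
    · nlinarith [mul_self_pos.2 hy, mul_self_nonneg (x i)]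

/-- Rotating only the `i`-th line of the frame gives Lagrangians on which Ω is `x · Ω E + y · Ω (E
with F i at i)`. -/
theorem frame_update_im_ne_zero {Ω : R2n 3 [⋀^Fin 3]→ₗ[ℝ] ℂ} (hΩ : Ω ∈ U 3)
    {E F : Fin 3 → R2n 3} (h : IsSymplecticFrame E F) (i : Fin 3) :
    (conj (Ω E) * Ω (Function.update E i (F i))).im ≠ 0 := by
  refine im_ne_zero_of_independent fun x y hxy => ?_
  have h1 := frame_apply_ne_zero hΩ h (Function.update 1 i x) (Function.update 0 i y) (by
    intro j
    by_cases hj : j = i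
    · subst hj; simpa using hxy
    · simp [hj])
  convert h1 using 1
  have h2 : (fun j => (Function.update 1 i x : Fin 3 → ℝ) j • E j
      + (Function.update 0 i y : Fin 3 → ℝ) j • F j)
      = Function.update E i (x • E i + y • F i) := by
    ext1 j
    by_cases hj : j = i
    · subst hj; simp
    · simp [hj]
  rw [h2, AlternatingMap.map_update_add, AlternatingMap.map_update_smul,
    AlternatingMap.map_update_smul, Function.update_eq_self]
  simp

theorem stdSympC_vec (x y : R2n 3) : stdSympC 3 ![x, y] = (sympBil 3 x y : ℂ) := rfl

/-- With two orthogonal hyperbolic pairs and a vector orthogonal to both, only two of the ten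
shuffles in ω ∧ Ω survive. -/
theorem primitive_contract {Ω : R2n 3 [⋀^Fin 3]→ₗ[ℝ] ℂ} (hΩ : wedge (stdSympC 3) Ω = 0)
    {a b c d x : R2n 3} (hab : sympBil 3 a b = 1) (hcd : sympBil 3 c d = 1)
    (hac : sympBil 3 a c = 0) (had : sympBil 3 a d = 0) (hbc : sympBil 3 b c = 0)
    (hbd : sympBil 3 b d = 0) (hax : sympBil 3 a x = 0) (hbx : sympBil 3 b x = 0)
    (hcx : sympBil 3 c x = 0) (hdx : sympBil 3 d x = 0) : Ω ![c, d, x] + Ω ![a, b, x] = 0 := by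
  have h := congrArg (fun f => f ![a, b, c, d, x]) hΩ
  simp only [AlternatingMap.zero_apply] at h
  rw [wedge_two_three] at h
  have e0 : ![a, b, c, d, x] 0 = a := rfl
  have e1 : ![a, b, c, d, x] 1 = b := rfl
  have e2 : ![a, b, c, d, x] 2 = c := rfl
  have e3 : ![a, b, c, d, x] 3 = d := rfl
  have e4 : ![a, b, c, d, x] 4 = x := rfl
  simp only [Nat.reduceAdd] at h
  have hcb := sympBil_swap b c
  have hdb := sympBil_swap b d
  have hxb := sympBil_swap b x
  simp only [e0, e1, e2, e3, e4, stdSympC_vec, hab, hcd, hac, had, hbc, hbd, hax, hbx, hcx,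
    hdx, hcb, hdb, hxb] at h
  push_cast at h
  linear_combination h

/-! ### The mixed coefficients and their diagonalisation. -/

/-- The coefficients of a `3`-form on triples with exactly one `y`-direction. -/
def mixedCoeff (Ω : R2n 3 [⋀^Fin 3]→ₗ[ℝ] ℂ) (i j : Fin 3) : ℂ :=
  Ω (Function.update (stdE 3) i (stdF 3 j))

/-- For distinct `i`, `j`, `k`, the two coefficients are, up to sign, Ω on `(e j, f j, e k)` and on
`(e i, f i, e k)`, whose sum vanishes by primitivity. -/
theorem mixedCoeff_symm {Ω : R2n 3 [⋀^Fin 3]→ₗ[ℝ] ℂ} (hΩ : wedge (stdSympC 3) Ω = 0)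
    (i j : Fin 3) : mixedCoeff Ω i j = mixedCoeff Ω j i := by
  have hs := isSymplecticFrame_std 3
  have key : ∀ i j k : Fin 3, i ≠ j → i ≠ k → j ≠ k →
      Ω ![stdE 3 j, stdF 3 j, stdE 3 k] + Ω ![stdE 3 i, stdF 3 i, stdE 3 k] = 0 := by
    intro i j k hij hik hjk
    apply primitive_contract hΩ <;>
      simp [hs.left, hs.right, hs.pair, hs.pair', hij, hik, hjk]
  have h01 : mixedCoeff Ω 0 1 = mixedCoeff Ω 1 0 := by
    simp only [mixedCoeff]
    rw [eq_vec_three (stdE 3), update_vec_zero, update_vec_one]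
    have := key 0 1 2 (by decide) (by decide) (by decide)
    rw [vec_swap_fst_snd Ω (stdE 3 1)]
    linear_combination -this
  have h02 : mixedCoeff Ω 0 2 = mixedCoeff Ω 2 0 := by
    simp only [mixedCoeff]
    rw [eq_vec_three (stdE 3), update_vec_zero, update_vec_two]
    have := key 0 2 1 (by decide) (by decide) (by decide)
    rw [vec_swap_snd_thd Ω (stdE 3 0) (stdF 3 0), vec_swap_snd_thd Ω (stdF 3 2) (stdE 3 2),
      vec_swap_fst_snd Ω (stdE 3 2)]
    linear_combination this
  have h12 : mixedCoeff Ω 1 2 = mixedCoeff Ω 2 1 := by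
    simp only [mixedCoeff]
    rw [eq_vec_three (stdE 3), update_vec_one, update_vec_two]
    have := key 1 2 0 (by decide) (by decide) (by decide)
    rw [vec_swap_snd_thd Ω (stdE 3 0) (stdE 3 2) (stdF 3 2), vec_swap_fst_snd Ω (stdE 3 2),
      vec_swap_snd_thd Ω (stdE 3 2), vec_swap_fst_snd Ω (stdE 3 1) (stdE 3 0),
      vec_swap_snd_thd Ω (stdE 3 1)]
    linear_combination -this
  fin_cases i <;> fin_cases j <;> first | rfl | assumption | (symm; assumption)

/-- The quadratic form `Im (conj a · B)` does not vanish on vectors with first coordinate `1`. -/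
theorem im_quadratic_ne_zero {Ω : R2n 3 [⋀^Fin 3]→ₗ[ℝ] ℂ} (hΩ : Ω ∈ U 3) (s t : ℝ) :
    (conj (Ω (stdE 3)) * (mixedCoeff Ω 0 0 + 2 * s * mixedCoeff Ω 0 1 + 2 * t * mixedCoeff Ω 0 2
      + s ^ 2 * mixedCoeff Ω 1 1 + 2 * s * t * mixedCoeff Ω 1 2 + t ^ 2 * mixedCoeff Ω 2 2)).im
      ≠ 0 := by
  have hs := isSymplecticFrame_std 3
  refine im_ne_zero_of_independent fun x y hxy => ?_
  set e := stdE 3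
  set f := stdF 3
  -- The vectors `e 1 - s e 0`, `e 2 - t e 0` span the part of the `e`-space orthogonal to `X`.
  -- Adding a line in the plane of `e 0` and `X` gives a Lagrangian on which Ω equals `x · a + y ·
  -- B(1, s, t)`, where `B(1, s, t)` is the quadratic form of the mixed coefficients.
  set X : R2n 3 := f 0 + (s • f 1 + t • f 2) with hX
  have h := ne_zero_of_isotropic hΩ
    (u := ![x • e 0 + y • X, e 1 + (-s) • e 0, e 2 + (-t) • e 0])
    (d := ![x • X + (-y) • e 0, f 1, f 2])
    (by
      intro i j
      fin_cases i <;> fin_cases j <;>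
        simp [hX, hs.left, hs.right, hs.pair, hs.pair'] <;> ring)
    (by
      intro i j hij
      fin_cases i <;> fin_cases j <;>
        first
        | exact absurd rfl hij
        | (simp [hX, hs.left, hs.right, hs.pair] <;> ring))
    (by
      intro i
      have : x ≠ 0 ∨ y ≠ 0 := by
        by_contra! hc
        exact hxy (by rw [hc.1, hc.2])
      fin_cases i
      · simp [hX, hs.left, hs.right, hs.pair, hs.pair']
        intro h0
        rcases this with hx | hy
        · nlinarith [mul_self_pos.2 hx, mul_self_nonneg y]
        · nlinarith [mul_self_pos.2 hy, mul_self_nonneg x]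
      · simp [hs.pair]
      · simp [hs.pair])
  convert h using 1
  have b10 := mixedCoeff_symm hΩ.1 1 0
  have b20 := mixedCoeff_symm hΩ.1 2 0
  have b21 := mixedCoeff_symm hΩ.1 2 1
  simp only [hX, vec_add_fst, vec_add_snd, vec_add_thd, vec_smul_fst, vec_smul_snd, vec_smul_thd,
    vec_eq_fst_snd, vec_eq_fst_thd, vec_eq_snd_thd]
  have c0 : ∀ j, Ω ![f j, e 1, e 2] = mixedCoeff Ω 0 j := by
    intro j
    rw [mixedCoeff, eq_vec_three (stdE 3), update_vec_zero]
  have c1 : ∀ j, Ω ![f j, e 0, e 2] = -mixedCoeff Ω 1 j := by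
    intro j
    rw [mixedCoeff, eq_vec_three (stdE 3), update_vec_one, vec_swap_fst_snd]
  have c2 : ∀ j, Ω ![f j, e 1, e 0] = -mixedCoeff Ω 2 j := by
    intro j
    rw [mixedCoeff, eq_vec_three (stdE 3), update_vec_two, vec_swap_snd_thd,
      vec_swap_fst_snd, vec_swap_snd_thd, neg_neg]
  have ce : Ω e = Ω ![e 0, e 1, e 2] := congrArg Ω (eq_vec_three e)
  simp only [c0, c1, c2, ce, b10, b20, b21]
  push_cast
  ring

/-- The affine plane `x = 1` is connected, so the form is positive there; homogeneity covers `x ≠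
0`. -/
theorem quadratic_nonneg {p00 p01 p02 p11 p12 p22 : ℝ} (h0 : 0 < p00)
    (h : ∀ s t : ℝ, p00 + 2 * s * p01 + 2 * t * p02 + s ^ 2 * p11 + 2 * s * t * p12
      + t ^ 2 * p22 ≠ 0) (x y z : ℝ) :
    0 ≤ x ^ 2 * p00 + 2 * x * y * p01 + 2 * x * z * p02 + y ^ 2 * p11 + 2 * y * z * p12
      + z ^ 2 * p22 := by
  have pos : ∀ s t : ℝ, 0 < p00 + 2 * s * p01 + 2 * t * p02 + s ^ 2 * p11 + 2 * s * t * p12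
      + t ^ 2 * p22 := by
    intro s t
    by_contra! hle
    let g : ℝ → ℝ := fun r => p00 + 2 * (r * s) * p01 + 2 * (r * t) * p02 + (r * s) ^ 2 * p11
      + 2 * (r * s) * (r * t) * p12 + (r * t) ^ 2 * p22
    have hg : ContinuousOn g (Set.Icc 0 1) := by
      apply Continuous.continuousOn
      fun_prop
    obtain ⟨r, -, hr⟩ := intermediate_value_Icc' zero_le_one hg
      (show (0 : ℝ) ∈ Set.Icc (g 1) (g 0) by
        constructor
        · simpa [g] using hle
        · simpa [g] using h0.le)
    exact h _ _ hr
  rcases eq_or_ne x 0 with rfl | hx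
  · by_contra! hneg
    set q := y ^ 2 * p11 + 2 * y * z * p12 + z ^ 2 * p22 with hq
    have hq0 : q < 0 := by rw [hq]; linarith
    -- At these two opposite points the quadratic part equals `-p00`, so the two values sum to zero
    -- although both are positive.
    have h1 := pos (Real.sqrt (-p00 / q) * y) (Real.sqrt (-p00 / q) * z)
    have h2 := pos (-Real.sqrt (-p00 / q) * y) (-Real.sqrt (-p00 / q) * z)
    have h3 : Real.sqrt (-p00 / q) ^ 2 = -p00 / q :=
      Real.sq_sqrt (div_nonneg_of_nonpos (by linarith) hq0.le)
    have h4 : Real.sqrt (-p00 / q) ^ 2 * q = -p00 := by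
      rw [h3, div_mul_cancel₀ _ hq0.ne]
    rw [hq] at h4
    linarith
  · have h1 := mul_pos (pow_pos (abs_pos.2 hx) 2) (pos (y / x) (z / x))
    rw [sq_abs] at h1
    refine h1.le.trans_eq ?_
    field_simp

theorem apply_linear_combination {V : Type*} [AddCommGroup V] [Module ℝ V]
    (f : V [⋀^Fin 3]→ₗ[ℝ] ℂ) (g : Fin 3 → V) (R : Matrix (Fin 3) (Fin 3) ℝ) :
    f (fun j => ∑ k, R k j • g k) = R.det * f g := by
  have h := apply_eq_det_smul (f.compLinearMap (Fintype.linearCombination ℝ g))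
    (Pi.basisFun ℝ (Fin 3)) (fun j k => R k j)
  rw [Module.Basis.det_apply] at h
  have e1 : (Pi.basisFun ℝ (Fin 3)).toMatrix (fun j k => R k j) = R := by
    ext i j; simp [Module.Basis.toMatrix_apply]
  rw [e1] at h
  simpa [AlternatingMap.compLinearMap_apply, Fintype.linearCombination_apply] using h

/-- The effect of an orthogonal change of frame on the derivative in a direction `X`. -/
theorem update_linear_combination {V : Type*} [AddCommGroup V] [Module ℝ V]
    (f : V [⋀^Fin 3]→ₗ[ℝ] ℂ) (g : Fin 3 → V) {R : Matrix (Fin 3) (Fin 3) ℝ} (hR : Rᵀ * R = 1)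
    (i : Fin 3) (X : V) :
    f (Function.update (fun j => ∑ k, R k j • g k) i X)
      = R.det * ∑ m, R m i * f (Function.update g m X) := by
  -- Translating `g m` by `R m i • X` changes, by orthogonality of `R`, only the `i`-th vector of
  -- the new frame, and by exactly `X`.
  have h1 := apply_linear_combination f (fun m => g m + R m i • X) R
  rw [apply_add_smul] at h1
  have h2 : (fun j => ∑ k, R k j • (g k + R k i • X))
      = Function.update (fun j => ∑ k, R k j • g k) i ((∑ k, R k i • g k) + X) := by
    ext1 j
    have h3 := congrFun (congrFun hR j) i
    rw [Matrix.mul_apply, Matrix.one_apply] at h3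
    simp only [Matrix.transpose_apply] at h3
    simp only [smul_add, smul_smul, Finset.sum_add_distrib, ← Finset.sum_smul, h3]
    by_cases hj : j = i
    · subst hj; simp
    · simp [hj]
  rw [h2, f.map_update_add, Function.update_eq_self i (fun j => ∑ k, R k j • g k),
    apply_linear_combination] at h1
  linear_combination h1

/-- The symplectic frame obtained from the standard one by a shear and a rotation. -/
theorem isSymplecticFrame_rotate {R T : Matrix (Fin 3) (Fin 3) ℝ} (hR : Rᵀ * R = 1)
    (hT : Tᵀ = T) :
    IsSymplecticFrame (fun j => ∑ k, R k j • stdE 3 k)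
      (fun j => ∑ k, R k j • (stdF 3 k + ∑ m, T m k • stdE 3 m)) := by
  have hs := isSymplecticFrame_std 3
  have hT' : ∀ i j, T i j = T j i := fun i j => congrFun (congrFun hT j) i
  have hR' : ∀ i j, ∑ k, R k i * R k j = if i = j then 1 else 0 := by
    intro i j
    have h3 := congrFun (congrFun hR i) j
    rwa [Matrix.mul_apply, Matrix.one_apply] at h3
  constructor
  · intro i j
    simp [hs.left]
  · intro i j
    simp [hs.left, hs.right, hs.pair, hs.pair', Fin.sum_univ_three]
    rw [hT' 1 0, hT' 2 0, hT' 2 1]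
    ring
  · intro i j
    rw [← hR']
    simp [hs.left, hs.pair, mul_comm]

/-- A form in `𝒰(3)` with positive mixed coefficient is diagonal in a suitable symplectic
frame. -/
theorem exists_diagonal_frame {Ω : R2n 3 [⋀^Fin 3]→ₗ[ℝ] ℂ} (hΩ : Ω ∈ U 3)
    (h0 : 0 < (conj (Ω (stdE 3)) * mixedCoeff Ω 0 0).im) :
    ∃ E F : Fin 3 → R2n 3, IsSymplecticFrame E F ∧
      (∀ i, 0 < (conj (Ω E) * Ω (Function.update E i (F i))).im) ∧
      ∀ i j, i ≠ j → Ω (Function.update E i (F j)) = 0 := by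
  set a := Ω (stdE 3) with ha
  let P : Matrix (Fin 3) (Fin 3) ℝ := fun i j => (conj a * mixedCoeff Ω i j).im
  have ha0 : a ≠ 0 := by
    intro h; rw [h] at h0; simp at h0
  have hn : Complex.normSq a ≠ 0 := by simpa using ha0
  -- The shear by `T` adds `T m k · a` to the mixed coefficients; this choice cancels the real part
  -- of `conj a · B` and leaves `i P`.
  let T : Matrix (Fin 3) (Fin 3) ℝ :=
    fun i j => -(conj a * mixedCoeff Ω i j).re / Complex.normSq a
  have hB := mixedCoeff_symm hΩ.1
  have hPs : P.IsHermitian := by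
    ext i j
    rw [Matrix.conjTranspose_apply, star_trivial]
    simp only [P, hB i j]
  have hTs : Tᵀ = T := by
    ext i j
    rw [Matrix.transpose_apply]
    simp only [T, hB i j]
  have hPT : ∀ i j, conj a * mixedCoeff Ω i j = -Complex.normSq a * T i j + Complex.I * P i j := by
    intro i j
    have : -(Complex.normSq a) * T i j = (conj a * mixedCoeff Ω i j).re := by
      simp only [T]; field_simp
    rw [← Complex.ofReal_neg, ← Complex.ofReal_mul, this]
    apply Complex.ext <;> simp [P]
  let R : Matrix (Fin 3) (Fin 3) ℝ := hPs.eigenvectorUnitary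
  have hR : Rᵀ * R = 1 := by
    have := Unitary.coe_star_mul_self hPs.eigenvectorUnitary
    rwa [Matrix.star_eq_conjTranspose, Matrix.conjTranspose_eq_transpose_of_trivial] at this
  have hD : Rᵀ * P * R = Matrix.diagonal hPs.eigenvalues := by
    have := hPs.conjStarAlgAut_star_eigenvectorUnitary
    rw [Unitary.conjStarAlgAut_star_apply, Matrix.star_eq_conjTranspose,
      Matrix.conjTranspose_eq_transpose_of_trivial] at this
    exact this
  have hdet : (R.det : ℂ) ^ 2 = 1 := by
    have h1 := congrArg Matrix.det hR
    rw [Matrix.det_mul, Matrix.det_transpose, Matrix.det_one] at h1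
    rw [pow_two]; exact_mod_cast h1
  have hfr := isSymplecticFrame_rotate hR hTs
  set E : Fin 3 → R2n 3 := fun j => ∑ k, R k j • stdE 3 k with hE
  set F : Fin 3 → R2n 3 := fun j => ∑ k, R k j • (stdF 3 k + ∑ m, T m k • stdE 3 m) with hF
  have hΩE : Ω E = R.det * a := apply_linear_combination Ω (stdE 3) R
  have hself : ∀ m k, Ω (Function.update (stdE 3) m (stdE 3 k)) = if m = k then a else 0 := by
    intro m k
    split_ifs with h
    · rw [← h, Function.update_eq_self]
    · exact Ω.map_update_self _ h
  have hcoef : ∀ m k, conj a * Ω (Function.update (stdE 3) m (stdF 3 k + ∑ l, T l k • stdE 3 l))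
      = Complex.I * P m k := by
    intro m k
    rw [Ω.map_update_add, Ω.map_update_sum]
    simp only [Ω.map_update_smul, hself]
    have : Complex.normSq a = conj a * a := Complex.normSq_eq_conj_mul_self
    have h1 := hPT m k
    rw [this] at h1
    simp only [mixedCoeff] at h1
    simp
    linear_combination h1
  have main : ∀ i j, conj (Ω E) * Ω (Function.update E i (F j))
      = Complex.I * ((Rᵀ * P * R) i j : ℝ) := by
    intro i j
    rw [hE, update_linear_combination Ω (stdE 3) hR, ← hE, hΩE, map_mul, Complex.conj_ofReal]
    have h1 : ∀ m, conj a * Ω (Function.update (stdE 3) m (F j))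
        = ∑ k, R k j * (Complex.I * P m k) := by
      intro m
      rw [hF, Ω.map_update_sum, Finset.mul_sum]
      refine Finset.sum_congr rfl fun k _ => ?_
      rw [Ω.map_update_smul, Complex.real_smul, ← hcoef]
      ring
    -- One determinant comes from each factor, so the sign of the orthogonal matrix drops out.
    calc _ = (R.det : ℂ) ^ 2 * ∑ m, R m i * (conj a * Ω (Function.update (stdE 3) m (F j))) := by
          simp only [Fin.sum_univ_three]; ring
      _ = _ := by
          simp only [hdet, h1, Matrix.mul_apply, Fin.sum_univ_three, Matrix.transpose_apply]
          push_cast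
          ring
  have hne : conj (Ω E) ≠ 0 := by
    rw [hΩE, map_ne_zero]
    refine mul_ne_zero ?_ ha0
    intro h; rw [h] at hdet; simp at hdet
  refine ⟨E, F, hfr, fun i => ?_, fun i j hij => ?_⟩
  -- Semidefiniteness of `P` on the columns of `R` gives `≥ 0`; non-vanishing on Lagrangians of the
  -- new frame makes it strict.
  · refine lt_of_le_of_ne ?_ (frame_update_im_ne_zero hΩ hfr i).symm
    rw [main]
    have hq := quadratic_nonneg (p00 := P 0 0) (p01 := P 0 1) (p02 := P 0 2) (p11 := P 1 1)
      (p12 := P 1 2) (p22 := P 2 2) h0 (fun s t => by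
        convert im_quadratic_ne_zero hΩ s t using 1
        simp [P, ← ha, pow_two]
        ring) (R 0 i) (R 1 i) (R 2 i)
    have s10 : P 1 0 = P 0 1 := by simp only [P, hB 1 0]
    have s20 : P 2 0 = P 0 2 := by simp only [P, hB 2 0]
    have s21 : P 2 1 = P 1 2 := by simp only [P, hB 2 1]
    refine hq.trans_eq ?_
    simp [Matrix.mul_apply, Fin.sum_univ_three, s10, s20, s21]
    ring
  · have := main i j
    rw [hD, Matrix.diagonal_apply_ne _ hij] at this
    simpa [hne] using this

/-! ### Six-forms evaluated on a symplectic frame. -/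

theorem conjForm_apply {V : Type*} [AddCommGroup V] [Module ℝ V] {p : ℕ}
    (α : V [⋀^Fin p]→ₗ[ℝ] ℂ) (v : Fin p → V) : conjForm α v = conj (α v) := rfl

/-- The vectors of a symplectic frame, as a family indexed by `Fin 6`. -/
def frameVec (E F : Fin 3 → R2n 3) : Fin 6 → R2n 3 := ![E 0, E 1, E 2, F 0, F 1, F 2]

-- The cube of ω is 6 on the ordering `E 0, F 0, E 1, F 1, E 2, F 2`; moving the `F`s behind the
-- `E`s is an odd permutation.
set_option maxRecDepth 20000 in
theorem symp_cube_frame {E F : Fin 3 → R2n 3} (h : IsSymplecticFrame E F) :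
    wedge (wedge (stdSympC 3) (stdSympC 3)) (stdSympC 3) (frameVec E F) = -6 := by
  have hη : ∀ a b c d : R2n 3, wedge (stdSympC 3) (stdSympC 3) ![a, b, c, d]
      = 2 * ((sympBil 3 a b : ℂ) * sympBil 3 c d - sympBil 3 a c * sympBil 3 b d
        + sympBil 3 a d * sympBil 3 b c) := by
    intro a b c d
    rw [wedge_two_two]
    have e0 : ![a, b, c, d] 0 = a := rfl
    have e1 : ![a, b, c, d] 1 = b := rfl
    have e2 : ![a, b, c, d] 2 = c := rfl
    have e3 : ![a, b, c, d] 3 = d := rfl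
    simp only [Nat.reduceAdd]
    simp only [e0, e1, e2, e3, stdSympC_vec, sympBil_swap b c, sympBil_swap a c,
      sympBil_swap b d]
    push_cast
    ring
  have key := wedge_four_two (wedge (stdSympC 3) (stdSympC 3) : R2n 3 [⋀^Fin 4]→ₗ[ℝ] ℂ)
    (stdSympC 3) (frameVec E F)
  refine key.trans ?_
  generalize (wedge (stdSympC 3) (stdSympC 3) : R2n 3 [⋀^Fin 4]→ₗ[ℝ] ℂ) = η at hη ⊢
  have e0 : frameVec E F 0 = E 0 := rfl
  have e1 : frameVec E F 1 = E 1 := rfl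
  have e2 : frameVec E F 2 = E 2 := rfl
  have e3 : frameVec E F 3 = F 0 := rfl
  have e4 : frameVec E F 4 = F 1 := rfl
  have e5 : frameVec E F 5 = F 2 := rfl
  simp only [Nat.reduceAdd] at hη ⊢
  simp only [e0, e1, e2, e3, e4, e5, hη, stdSympC_vec, h.left, h.right, h.pair, h.pair']
  simp
  norm_num

theorem frameVec_linearIndependent {E F : Fin 3 → R2n 3} (h : IsSymplecticFrame E F) :
    LinearIndependent ℝ (frameVec E F) := by
  refine linearIndependent_of_pairing (d := ![F 0, F 1, F 2, E 0, E 1, E 2]) ?_ ?_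
  · intro i j hij
    fin_cases i <;> fin_cases j <;>
      first
      | exact absurd rfl hij
      | simp [frameVec, h.left, h.right, h.pair, h.pair']
  · intro i
    fin_cases i <;> simp [frameVec, h.pair, h.pair']

/-- Two `6`-forms that agree on a symplectic frame are equal. -/
theorem form_ext_of_frame {E F : Fin 3 → R2n 3} (h : IsSymplecticFrame E F)
    {f g : R2n 3 [⋀^Fin 6]→ₗ[ℝ] ℂ} (hfg : f (frameVec E F) = g (frameVec E F)) : f = g := by
  let b := basisOfLinearIndependentOfCardEqFinrank (frameVec_linearIndependent h) (by simp)
  have hb : ⇑b = frameVec E F := coe_basisOfLinearIndependentOfCardEqFinrank _ _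
  ext v
  rw [apply_eq_det_smul f b, apply_eq_det_smul g b, hb, hfg]

/-- The coefficients of a `3`-form on the coordinate planes of a frame. -/
def frameCoeff (Ω : R2n 3 [⋀^Fin 3]→ₗ[ℝ] ℂ) (E F : Fin 3 → R2n 3) (i j k : Fin 2) : ℂ :=
  Ω ![(![E, F] : Fin 2 → Fin 3 → R2n 3) i 0, (![E, F] : Fin 2 → Fin 3 → R2n 3) j 1,
    (![E, F] : Fin 2 → Fin 3 → R2n 3) k 2]

/-- The pairing of the real and imaginary parts of a `3`-form that is diagonal in a frame. -/
def framePairing (Ω : R2n 3 [⋀^Fin 3]→ₗ[ℝ] ℂ) (E F : Fin 3 → R2n 3) : ℝ :=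
  (conj (frameCoeff Ω E F 0 0 0) * frameCoeff Ω E F 1 1 1).im
    - (conj (frameCoeff Ω E F 1 0 0) * frameCoeff Ω E F 0 1 1).im
    - (conj (frameCoeff Ω E F 0 1 0) * frameCoeff Ω E F 1 0 1).im
    - (conj (frameCoeff Ω E F 0 0 1) * frameCoeff Ω E F 1 1 0).im

/-- If a triple contains both `E j` and `F j`, then either it or its complement has exactly one `F`,
and that coefficient is off-diagonal, hence zero. The other eight terms form four complementary
pairs, each contributing `±2 Im`. -/
theorem wedge_conj_frame {Ω : R2n 3 [⋀^Fin 3]→ₗ[ℝ] ℂ} {E F : Fin 3 → R2n 3}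
    (h0 : ∀ i j, i ≠ j → Ω (Function.update E i (F j)) = 0) :
    Complex.I * wedge Ω (conjForm Ω) (frameVec E F)
      = ((2 * framePairing Ω E F : ℝ) : ℂ) := by
  have z0 : ∀ j, j ≠ 0 → Ω ![F j, E 1, E 2] = 0 := fun j hj => by
    rw [← h0 0 j hj.symm, eq_vec_three E, update_vec_zero]; simp
  have z1 : ∀ j, j ≠ 1 → Ω ![E 0, F j, E 2] = 0 := fun j hj => by
    rw [← h0 1 j hj.symm, eq_vec_three E, update_vec_one]; simp
  have z2 : ∀ j, j ≠ 2 → Ω ![E 0, E 1, F j] = 0 := fun j hj => by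
    rw [← h0 2 j hj.symm, eq_vec_three E, update_vec_two]; simp
  have y1 : Ω ![E 0, F 1, E 1] = 0 := by rw [vec_swap_snd_thd, z2 1 (by decide), neg_zero]
  have y2 : Ω ![F 0, E 0, E 1] = 0 := by
    rw [vec_swap_fst_snd, vec_swap_snd_thd, z2 0 (by decide), neg_zero, neg_zero]
  have y3 : Ω ![E 0, E 2, F 2] = 0 := by rw [vec_swap_snd_thd, z1 2 (by decide), neg_zero]
  have y4 : Ω ![F 0, E 0, E 2] = 0 := by rw [vec_swap_fst_snd, z1 0 (by decide), neg_zero]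
  have y5 : Ω ![E 1, E 2, F 2] = 0 := by
    rw [vec_swap_snd_thd, vec_swap_fst_snd, z0 2 (by decide), neg_zero, neg_zero]
  have y6 : Ω ![E 1, F 1, E 2] = 0 := by rw [vec_swap_fst_snd, z0 1 (by decide), neg_zero]
  have key := wedge_three_three Ω (conjForm Ω) (frameVec E F)
  have e0 : frameVec E F 0 = E 0 := rfl
  have e1 : frameVec E F 1 = E 1 := rfl
  have e2 : frameVec E F 2 = E 2 := rfl
  have e3 : frameVec E F 3 = F 0 := rfl
  have e4 : frameVec E F 4 = F 1 := rfl
  have e5 : frameVec E F 5 = F 2 := rfl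
  simp only [Nat.reduceAdd] at key ⊢
  rw [key]
  simp only [e0, e1, e2, e3, e4, e5, conjForm_apply, y1, y2, y3, y4, y5, y6,
    z0 1 (by decide), z0 2 (by decide), z1 0 (by decide), z1 2 (by decide), z2 0 (by decide),
    z2 1 (by decide), framePairing, frameCoeff]
  apply Complex.ext <;> simp <;> ring

theorem triEval_frameCoeff (Ω : R2n 3 [⋀^Fin 3]→ₗ[ℝ] ℂ) (E F : Fin 3 → R2n 3)
    (x y x' y' x'' y'' : ℝ) : triEval (frameCoeff Ω E F) x y x' y' x'' y''
      = Ω (fun i => ![x, x', x''] i • E i + ![y, y', y''] i • F i) := by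
  rw [eq_vec_three (fun i => _ • E i + _)]
  simp only [vec_add_fst, vec_add_snd, vec_add_thd, vec_smul_fst, vec_smul_snd, vec_smul_thd,
    triEval, frameCoeff]
  simp
  ring

theorem exists_framePairing_neg {Ω : R2n 3 [⋀^Fin 3]→ₗ[ℝ] ℂ} (hΩ : Ω ∈ U 3)
    (h0 : 0 < (conj (Ω (stdE 3)) * mixedCoeff Ω 0 0).im) :
    ∃ E F : Fin 3 → R2n 3, IsSymplecticFrame E F ∧
      (∀ i j, i ≠ j → Ω (Function.update E i (F j)) = 0) ∧ framePairing Ω E F < 0 := by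
  obtain ⟨E, F, hfr, hpos, hoff⟩ := exists_diagonal_frame hΩ h0
  refine ⟨E, F, hfr, hoff, tri_pairing_neg (frameCoeff Ω E F)
    (fun x y x' y' x'' y'' h h' h'' => ?_) ?_ ?_ ?_⟩
  · rw [triEval_frameCoeff]
    refine frame_apply_ne_zero hΩ hfr _ _ fun i => ?_
    fin_cases i <;> assumption
  · convert hpos 0 using 4 <;> rw [eq_vec_three E] <;> simp [frameCoeff, update_vec_zero]
  · convert hpos 1 using 4 <;> rw [eq_vec_three E] <;> simp [frameCoeff, update_vec_one]
  · convert hpos 2 using 4 <;> rw [eq_vec_three E] <;> simp [frameCoeff, update_vec_two]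

/-- The factor is the quotient of twice the pairing by the value -6 of ω³ on the frame. -/
theorem I_smul_wedge_conj {Ω : R2n 3 [⋀^Fin 3]→ₗ[ℝ] ℂ} {E F : Fin 3 → R2n 3}
    (hfr : IsSymplecticFrame E F) (hoff : ∀ i j, i ≠ j → Ω (Function.update E i (F j)) = 0) :
    Complex.I • wedge Ω (conjForm Ω) = (-framePairing Ω E F / 3)
      • wedge (wedge (stdSympC 3) (stdSympC 3)) (stdSympC 3) := by
  refine form_ext_of_frame hfr ((wedge_conj_frame hoff).trans ?_)
  refine Eq.trans ?_ (congrArg (fun z : ℂ => (-framePairing Ω E F / 3) • z)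
    (symp_cube_frame hfr).symm)
  rw [Complex.real_smul]
  push_cast
  ring

theorem I_smul_wedge_conj_of_pos {Ω : R2n 3 [⋀^Fin 3]→ₗ[ℝ] ℂ} (hΩ : Ω ∈ U 3)
    (h0 : 0 < (conj (Ω (stdE 3)) * mixedCoeff Ω 0 0).im) :
    ∃ c : ℝ, 0 < c ∧ Complex.I • wedge Ω (conjForm Ω)
      = c • wedge (wedge (stdSympC 3) (stdSympC 3)) (stdSympC 3) := by
  obtain ⟨E, F, hfr, hoff, hneg⟩ := exists_framePairing_neg hΩ h0
  exact ⟨_, by linarith, I_smul_wedge_conj hfr hoff⟩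

theorem wedge_stdSympC_conj (Ω : R2n 3 [⋀^Fin 3]→ₗ[ℝ] ℂ) :
    wedge (stdSympC 3) (conjForm Ω) = conjForm (wedge (stdSympC 3) Ω) := by
  ext v
  rw [conjForm_apply, wedge_two_three, wedge_two_three]
  simp only [conjForm_apply, stdSympC_vec, map_add, map_sub, map_mul, Complex.conj_ofReal]

theorem conjForm_mem_U {Ω : R2n 3 [⋀^Fin 3]→ₗ[ℝ] ℂ} (hΩ : Ω ∈ U 3) : conjForm Ω ∈ U 3 := by
  refine ⟨?_, fun L hL h0 => hΩ.2 L hL ?_⟩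
  · rw [wedge_stdSympC_conj, hΩ.1]
    ext v; simp [conjForm_apply]
  · ext v
    have h1 := congrArg (fun f => f v) h0
    simpa [conjForm_apply] using h1

theorem framePairing_conjForm (Ω : R2n 3 [⋀^Fin 3]→ₗ[ℝ] ℂ) (E F : Fin 3 → R2n 3) :
    framePairing (conjForm Ω) E F = -framePairing Ω E F := by
  simp only [framePairing, frameCoeff, conjForm_apply, ← map_mul, Complex.conj_im]
  ring

/-- Conjugation preserves `U 3` and reverses the signs of both the mixed coefficient and the
pairing. -/
theorem I_smul_wedge_conj_of_neg {Ω : R2n 3 [⋀^Fin 3]→ₗ[ℝ] ℂ} (hΩ : Ω ∈ U 3)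
    (h0 : (conj (Ω (stdE 3)) * mixedCoeff Ω 0 0).im < 0) :
    ∃ c : ℝ, c < 0 ∧ Complex.I • wedge Ω (conjForm Ω)
      = c • wedge (wedge (stdSympC 3) (stdSympC 3)) (stdSympC 3) := by
  obtain ⟨E, F, hfr, hoff, hneg⟩ := exists_framePairing_neg (conjForm_mem_U hΩ) (by
    simp only [mixedCoeff, conjForm_apply] at h0 ⊢
    rw [← map_mul, Complex.conj_im]
    linarith)
  rw [framePairing_conjForm] at hneg
  refine ⟨_, by linarith, I_smul_wedge_conj hfr fun i j hij => ?_⟩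
  have h := hoff i j hij
  rwa [conjForm_apply, map_eq_zero] at h

theorem symp_cube_ne_zero : wedge (wedge (stdSympC 3) (stdSympC 3)) (stdSympC 3) ≠ 0 := by
  intro h
  have h1 := symp_cube_frame (isSymplecticFrame_std 3)
  rw [h] at h1
  simp at h1

/-! ### The degree of the phase along the canonical loop. -/

theorem phase_loopLag (Ω : R2n 3 [⋀^Fin 3]→ₗ[ℝ] ℂ) (t : ℝ) :
    phase Ω (loopLag 3 t) = ((Complex.arg (Real.cos t * Ω (stdE 3)
      + Real.sin t * mixedCoeff Ω 0 0) : ℝ) : AddCircle Real.pi) := by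
  rw [phase_eq Ω (loopLag 3 t) ((Pi.basisFun ℝ (Fin 3)).map
    (LinearEquiv.ofInjective (loopMap 3 t) (loopMap_injective 3 t)))]
  congr 2
  have h : (fun j => ((((Pi.basisFun ℝ (Fin 3)).map
      (LinearEquiv.ofInjective (loopMap 3 t) (loopMap_injective 3 t))) j : _) : R2n 3))
      = ![Real.cos t • stdE 3 0 + Real.sin t • stdF 3 0, stdE 3 1, stdE 3 2] := by
    ext1 j
    have h1 : ((((Pi.basisFun ℝ (Fin 3)).map
      (LinearEquiv.ofInjective (loopMap 3 t) (loopMap_injective 3 t))) j : _) : R2n 3)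
      = loopMap 3 t (Pi.single j 1) := by simp
    refine h1.trans ?_
    fin_cases j <;> ext k <;> fin_cases k <;> simp [loopMap, stdE, stdF]
  refine (congrArg Ω h).trans ?_
  rw [vec_add_fst, vec_smul_fst, vec_smul_fst, mixedCoeff, eq_vec_three (stdE 3), update_vec_zero]
  simp

theorem coe_arg_eq {r θ : ℝ} (hr : 0 < r) :
    ((Complex.arg (r * Complex.exp (θ * Complex.I)) : ℝ) : AddCircle Real.pi)
      = (θ : AddCircle Real.pi) := by
  have h1 : ((Complex.arg (r * Complex.exp (θ * Complex.I)) : ℝ) : Real.Angle) = (θ : Real.Angle) :=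
    by
      rw [Complex.exp_mul_I]
      simpa using Complex.arg_mul_cos_add_sin_mul_I_coe_angle hr θ
  obtain ⟨k, hk⟩ := Real.Angle.angle_eq_iff_two_pi_dvd_sub.1 h1
  have h4 : Complex.arg (r * Complex.exp (θ * Complex.I)) = θ + ((2 * k : ℤ) : ℝ) * Real.pi := by
    push_cast; linarith
  rw [h4, AddCircle.coe_add, ← zsmul_eq_mul, AddCircle.coe_zsmul, AddCircle.coe_period]
  simp

/-- Two continuous lifts of the same loop have the same degree. -/
theorem degree_unique {f : AddCircle Real.pi → AddCircle Real.pi} {d d' : ℤ}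
    (h : HasDegree f d) (h' : HasDegree f d') : d = d' := by
  obtain ⟨g, hg, hgf, hd⟩ := h
  obtain ⟨g', hg', hgf', hd'⟩ := h'
  have hsin : ∀ t, ∃ k : ℤ, g t - g' t = k * Real.pi := by
    intro t
    have h1 : ((g t - g' t : ℝ) : AddCircle Real.pi) = 0 := by
      rw [AddCircle.coe_sub, hgf, hgf', sub_self]
    obtain ⟨k, hk⟩ := (AddCircle.coe_eq_zero_iff _).1 h1
    exact ⟨k, by rw [← hk, zsmul_eq_mul]⟩
  choose k hk using hsin
  have hkc : Continuous fun t => (k t : ℝ) := by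
    have : (fun t => (k t : ℝ)) = fun t => (g t - g' t) / Real.pi := by
      ext t; rw [hk, mul_div_cancel_right₀ _ Real.pi_ne_zero]
    rw [this]
    fun_prop
  -- The two lifts differ by π times an integer depending continuously on `t`, hence by a constant.
  have hkc' : Continuous k := Int.isClosedEmbedding_coe_real.isEmbedding.continuous_iff.2 hkc
  have h0 : k (0 + Real.pi) = k 0 :=
    PreconnectedSpace.constant inferInstance hkc'
  have h1 := hk (0 + Real.pi)
  rw [h0, ← hk, hd, hd'] at h1
  have h2 : (d : ℝ) * Real.pi = d' * Real.pi := by linarith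
  exact_mod_cast mul_right_cancel₀ Real.pi_ne_zero h2

/-- The argument of a positively oriented ellipse has degree one. -/
theorem exists_lift_of_pos {a b : ℂ} (h : 0 < (conj a * b).im) :
    ∃ g : ℝ → ℝ, Continuous g ∧ (∀ t : ℝ, ((g t : ℝ) : AddCircle Real.pi)
      = ((Complex.arg (Real.cos t * a + Real.sin t * b) : ℝ) : AddCircle Real.pi)) ∧
      ∀ t, g (t + Real.pi) = g t + Real.pi := by
  have hlt := norm_add_I_mul_lt h
  set p := a - Complex.I * b
  set q := a + Complex.I * b
  have hp : p ≠ 0 := by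
    intro h0
    rw [h0, norm_zero] at hlt
    exact absurd hlt (not_lt.2 (norm_nonneg _))
  -- The ellipse is `(p / 2) · e^{it} · u t`. As `|q| < |p|`, `u` stays in the unit disc about 1,
  -- where the argument is continuous; it is π-periodic, so only `e^{it}` contributes to the degree.
  let u : ℝ → ℂ := fun t => 1 + q / p * Complex.exp ((-2 * t : ℝ) * Complex.I)
  have hu : ∀ t, u t ∈ Complex.slitPlane := by
    intro t
    refine Complex.mem_slitPlane_of_norm_lt_one ?_
    rw [norm_mul, Complex.norm_exp_ofReal_mul_I, mul_one, norm_div]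
    exact (div_lt_one (norm_pos_iff.2 hp)).2 hlt
  refine ⟨fun t => t + p.arg + (u t).arg, ?_, ?_, ?_⟩
  · have hc : Continuous u := by fun_prop
    have : Continuous fun t => (u t).arg :=
      continuous_iff_continuousAt.2 fun t =>
        (Complex.continuousAt_arg (hu t)).comp hc.continuousAt
    fun_prop
  · intro t
    have hu0 : u t ≠ 0 := Complex.slitPlane_ne_zero (hu t)
    have h1 : Real.cos t * a + Real.sin t * b = ((‖p‖ * ‖u t‖ / 2 : ℝ) : ℂ)
        * Complex.exp ((t + p.arg + (u t).arg : ℝ) * Complex.I) := by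
      have e1 := Complex.norm_mul_exp_arg_mul_I p
      have e2 := Complex.norm_mul_exp_arg_mul_I (u t)
      have e3 : ((‖p‖ * ‖u t‖ / 2 : ℝ) : ℂ)
          * Complex.exp ((t + p.arg + (u t).arg : ℝ) * Complex.I)
          = Complex.exp (t * Complex.I) * p * u t / 2 := by
        push_cast
        rw [add_mul, add_mul, Complex.exp_add, Complex.exp_add]
        linear_combination Complex.exp (t * Complex.I) * ‖u t‖
          * Complex.exp ((u t).arg * Complex.I) / 2 * e1 + Complex.exp (t * Complex.I) * p / 2 * e2
      rw [e3]
      have e4 : Complex.exp (t * Complex.I) * Complex.exp ((-2 * t : ℝ) * Complex.I)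
          = Complex.exp (-t * Complex.I) := by
        rw [← Complex.exp_add]; congr 1; push_cast; ring
      have e5 : Complex.exp (t * Complex.I) * p * u t
          = Complex.exp (t * Complex.I) * p + Complex.exp (-t * Complex.I) * q := by
        rw [← e4]; simp only [u]; field_simp
      rw [e5, Complex.ofReal_cos, Complex.ofReal_sin, Complex.exp_mul_I, Complex.exp_mul_I,
        Complex.cos_neg, Complex.sin_neg]
      simp only [p, q]
      linear_combination Complex.sin t * b * Complex.I_sq
    rw [h1, coe_arg_eq (by positivity)]
  · intro t
    have : u (t + Real.pi) = u t := by
      simp only [u]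
      congr 2
      rw [show ((-2 * (t + Real.pi) : ℝ) : ℂ) * Complex.I
        = ((-2 * t : ℝ) : ℂ) * Complex.I - 2 * Real.pi * Complex.I by push_cast; ring,
        Complex.exp_periodic.sub_eq]
    simp only [this]; ring

theorem phase_canonicalLoop (Ω : R2n 3 [⋀^Fin 3]→ₗ[ℝ] ℂ) (t : ℝ) :
    (phase Ω ∘ canonicalLoop 3) (t : AddCircle Real.pi)
      = ((Complex.arg (Real.cos t * Ω (stdE 3) + Real.sin t * mixedCoeff Ω 0 0) : ℝ) :
        AddCircle Real.pi) := by
  rw [← phase_loopLag]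
  rfl

theorem hasDegree_one {Ω : R2n 3 [⋀^Fin 3]→ₗ[ℝ] ℂ}
    (h : 0 < (conj (Ω (stdE 3)) * mixedCoeff Ω 0 0).im) :
    HasDegree (phase Ω ∘ canonicalLoop 3) 1 := by
  obtain ⟨g, hg, hg1, hg2⟩ := exists_lift_of_pos h
  exact ⟨g, hg, fun t => by rw [hg1, phase_canonicalLoop], fun t => by rw [hg2]; simp⟩

theorem hasDegree_neg_one {Ω : R2n 3 [⋀^Fin 3]→ₗ[ℝ] ℂ}
    (h : (conj (Ω (stdE 3)) * mixedCoeff Ω 0 0).im < 0) :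
    HasDegree (phase Ω ∘ canonicalLoop 3) (-1) := by
  -- Negating `b` and reversing time gives the same ellipse with the opposite orientation.
  obtain ⟨g, hg, hg1, hg2⟩ := exists_lift_of_pos (a := Ω (stdE 3)) (b := -mixedCoeff Ω 0 0)
    (by rw [mul_neg, Complex.neg_im]; linarith)
  refine ⟨fun t => g (-t), by fun_prop, fun t => ?_, fun t => ?_⟩
  · rw [hg1, phase_canonicalLoop, Real.cos_neg, Real.sin_neg]
    congr 3
    push_cast; ring
  · have := hg2 (-t - Real.pi)
    rw [sub_add_cancel] at this
    simp only [neg_add']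
    rw [this]
    push_cast; ring

end LagrangianForms

end

theorem mainTheorem11 (Ω : LagrangianForms.R2n 3 [⋀^Fin 3]→ₗ[ℝ] ℂ)
    (hΩ : Ω ∈ LagrangianForms.U 3) :
    LagrangianForms.wedge Ω (LagrangianForms.conjForm Ω) ≠ 0 ∧
    (Ω ∈ LagrangianForms.UPlus 3 → ∃ c : ℝ, 0 < c ∧
      Complex.I • LagrangianForms.wedge Ω (LagrangianForms.conjForm Ω) =
        c • LagrangianForms.wedge
          (LagrangianForms.wedge (LagrangianForms.stdSympC 3) (LagrangianForms.stdSympC 3))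
          (LagrangianForms.stdSympC 3)) ∧
    (Ω ∈ LagrangianForms.UMinus 3 → ∃ c : ℝ, c < 0 ∧
      Complex.I • LagrangianForms.wedge Ω (LagrangianForms.conjForm Ω) =
        c • LagrangianForms.wedge
          (LagrangianForms.wedge (LagrangianForms.stdSympC 3) (LagrangianForms.stdSympC 3))
          (LagrangianForms.stdSympC 3)) := by
  open LagrangianForms in
  have hne : ∀ c : ℝ, c ≠ 0 → Complex.I • wedge Ω (conjForm Ω)
      = c • wedge (wedge (stdSympC 3) (stdSympC 3)) (stdSympC 3) →
      wedge Ω (conjForm Ω) ≠ 0 := by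
    intro c hc h h0
    rw [h0, smul_zero] at h
    exact (smul_ne_zero hc symp_cube_ne_zero) h.symm
  -- The sign of this number determines the degree, ±1, so membership in the other class contradicts
  -- uniqueness of the degree.
  rcases lt_or_gt_of_ne (frame_update_im_ne_zero hΩ (isSymplecticFrame_std 3) 0) with h | h
  · obtain ⟨c, hc, hc'⟩ := I_smul_wedge_conj_of_neg hΩ h
    refine ⟨hne c hc.ne hc', ?_, fun _ => ⟨c, hc, hc'⟩⟩
    rintro ⟨-, d, hd, hdeg⟩
    have := degree_unique hdeg (hasDegree_neg_one h)
    omega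
  · obtain ⟨c, hc, hc'⟩ := I_smul_wedge_conj_of_pos hΩ h
    refine ⟨hne c hc.ne' hc', fun _ => ⟨c, hc, hc'⟩, ?_⟩
    rintro ⟨-, d, hd, hdeg⟩
    have := degree_unique hdeg (hasDegree_one h)
    omega
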